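/- Let $P$ be an array of $n$ points of $\mathbb{R}^2$, each carrying one of $k\ge 1$ given colors, every color occurring at least once. A rectangular annulus is the closed region between two axis-parallel rectangles $C_{out}\supseteq C_{in}$ with the same center whose lengths and whose heights differ by the same amount $2w\ge 0$ (here $C_{out}$ is a proper rectangle, and $C_{in}$ may degenerate to a segment or a point, in which case the annulus is the whole rectangle bounded by $C_{out}$); $w$ is its width. It is color-spanning (a CSRA) if it contains at least one point of each color. Given $P$, a color-spanning rectangular annulus of minimum width can be computed in $O(n^4\log n)$ time with $O(k)$ extra space. Precisely: there are one program of the real RAM (unit-cost additions, subtractions and comparisons of reals; integer words of $O(\log n)$ bits) and one constant $C$ such that for every such input the program halts, outputs $C_{out}$ and $C_{in}$ of a minimum-width CSRA, takes at most $C\,n^4\log n$ elementary steps if $n\ge 2$, and uses, besides the input array, in which it may only read and swap entries, at most $Ck$ integer cells and at most $Ck$ real cells. -/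

import Mathlib

/-! ### Colored points and rectangular annuli -/

/-- A point of the plane with one of the `k` colors. -/
structure ColoredPoint (k : ℕ) where
  x : ℝ
  y : ℝ
  color : Fin k

/-- An axis-parallel rectangle, given by the coordinates of its four sides. -/
structure Rect where
  left : ℝ
  right : ℝ
  bottom : ℝ
  top : ℝ

namespace Rect

def length (R : Rect) : ℝ := R.right - R.left

def height (R : Rect) : ℝ := R.top - R.bottom

/-- `(x, y)` lies in the closed rectangle. -/
def Mem (R : Rect) (x y : ℝ) : Prop :=
  R.left ≤ x ∧ x ≤ R.right ∧ R.bottom ≤ y ∧ y ≤ R.top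

/-- `(x, y)` lies strictly inside the rectangle. -/
def MemInterior (R : Rect) (x y : ℝ) : Prop :=
  R.left < x ∧ x < R.right ∧ R.bottom < y ∧ y < R.top

end Rect

/-- `Cout` and `Cin` bound a rectangular annulus: they have the same center, and the two side
lengths of `Cout` exceed those of `Cin` by the same nonnegative amount, so that all four pairs of
similar sides are at the same distance. `Cout` is a proper rectangle; `Cin` may degenerate to a
segment or a point, in which case nothing lies strictly inside it and the annulus is all of
`Cout`. -/
structure IsRectAnnulus (Cout Cin : Rect) : Prop where
  outer_length_pos : 0 < Cout.length
  outer_height_pos : 0 < Cout.height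
  inner_length_nonneg : 0 ≤ Cin.length
  inner_height_nonneg : 0 ≤ Cin.height
  center_x : (Cout.left + Cout.right) / 2 = (Cin.left + Cin.right) / 2
  center_y : (Cout.bottom + Cout.top) / 2 = (Cin.bottom + Cin.top) / 2
  same_offset : Cout.length - Cin.length = Cout.height - Cin.height
  inner_le_outer : Cin.length ≤ Cout.length

/-- The width of the annulus: half of the difference of the side lengths. -/
noncomputable def annulusWidth (Cout Cin : Rect) : ℝ := (Cout.length - Cin.length) / 2

/-- The closed region between the two rectangles (both boundaries belong to it). -/
def InAnnulus (Cout Cin : Rect) (x y : ℝ) : Prop := Cout.Mem x y ∧ ¬ Cin.MemInterior x y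

/-- A color-spanning rectangular annulus: it contains a point of every color. -/
def IsCSRA {n k : ℕ} (P : Fin n → ColoredPoint k) (Cout Cin : Rect) : Prop :=
  IsRectAnnulus Cout Cin ∧
    ∀ c : Fin k, ∃ i : Fin n, (P i).color = c ∧ InAnnulus Cout Cin (P i).x (P i).y

/-- A color-spanning rectangular annulus of minimum width. -/
def IsMinWidthCSRA {n k : ℕ} (P : Fin n → ColoredPoint k) (Cout Cin : Rect) : Prop :=
  IsCSRA P Cout Cin ∧
    ∀ Cout' Cin' : Rect, IsCSRA P Cout' Cin' → annulusWidth Cout Cin ≤ annulusWidth Cout' Cin'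

/-! ### A real RAM with an input array that can only be permuted

Programs are finite terms that know neither the input nor its size. The machine has integer cells
(words), real cells, and the input array of colored points. The input array can be read and two of
its entries can be swapped; nothing else can be written to it. -/

/-- Integer expressions. -/
inductive IExpr where
  | const (c : ℕ)
  /-- content of the integer cell with the given address -/
  | cell (addr : IExpr)
  /-- color of the input array entry with the given index -/
  | color (idx : IExpr)
  | add (a b : IExpr)
  /-- truncated subtraction -/
  | sub (a b : IExpr)
  /-- half, rounded down -/
  | half (a : IExpr)

/-- Real expressions. There is no way to turn a real number into an integer. -/
inductive RExpr where
  | const (c : ℕ)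
  /-- content of the real cell with the given address -/
  | cell (addr : IExpr)
  /-- abscissa of the input array entry with the given index -/
  | x (idx : IExpr)
  /-- ordinate of the input array entry with the given index -/
  | y (idx : IExpr)
  | add (a b : RExpr)
  | sub (a b : RExpr)

/-- Tests. -/
inductive BExpr where
  | ilt (a b : IExpr)
  | rlt (a b : RExpr)
  | not (b : BExpr)
  | and (b c : BExpr)

/-- Programs. -/
inductive Cmd where
  | skip
  /-- write an integer cell -/
  | setI (addr : IExpr) (e : IExpr)
  /-- write a real cell -/
  | setR (addr : IExpr) (e : RExpr)
  /-- exchange two entries of the input array -/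
  | swap (i j : IExpr)
  | seq (c d : Cmd)
  | ite (b : BExpr) (c d : Cmd)
  | while (b : BExpr) (c : Cmd)

/-- The state of the machine on an input of `n` points with `k` colors. -/
structure RamState (n k : ℕ) where
  imem : ℕ → ℕ
  rmem : ℕ → ℝ
  pts : Fin n → ColoredPoint k

/-- A word holds an integer between `0` and `W`; overflow is a failure. -/
def toWord (W v : ℕ) : Option ℕ := if v ≤ W then some v else none

/-- Value of an integer expression when words hold the integers up to `W` and there are `S` integer
cells; `none` in the case of an overflow or of an illegal address. -/
def IExpr.eval {n k : ℕ} (W S : ℕ) (s : RamState n k) : IExpr → Option ℕ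
  | .const c => toWord W c
  | .cell a => (a.eval W S s).bind fun i => if i < S then some (s.imem i) else none
  | .color a => (a.eval W S s).bind fun i =>
      if h : i < n then toWord W (s.pts ⟨i, h⟩).color else none
  | .add a b => (a.eval W S s).bind fun u => (b.eval W S s).bind fun v => toWord W (u + v)
  | .sub a b => (a.eval W S s).bind fun u => (b.eval W S s).bind fun v => some (u - v)
  | .half a => (a.eval W S s).bind fun u => some (u / 2)

/-- Value of a real expression, with `S` real cells. -/
noncomputable def RExpr.eval {n k : ℕ} (W S : ℕ) (s : RamState n k) : RExpr → Option ℝ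
  | .const c => some (c : ℝ)
  | .cell a => (a.eval W S s).bind fun i => if i < S then some (s.rmem i) else none
  | .x a => (a.eval W S s).bind fun i => if h : i < n then some (s.pts ⟨i, h⟩).x else none
  | .y a => (a.eval W S s).bind fun i => if h : i < n then some (s.pts ⟨i, h⟩).y else none
  | .add a b => (a.eval W S s).bind fun u => (b.eval W S s).bind fun v => some (u + v)
  | .sub a b => (a.eval W S s).bind fun u => (b.eval W S s).bind fun v => some (u - v)

/-- Value of a test. -/
noncomputable def BExpr.eval {n k : ℕ} (W S : ℕ) (s : RamState n k) : BExpr → Option Bool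
  | .ilt a b => (a.eval W S s).bind fun u => (b.eval W S s).bind fun v => some (decide (u < v))
  | .rlt a b => (a.eval W S s).bind fun u => (b.eval W S s).bind fun v => some (decide (u < v))
  | .not b => (b.eval W S s).bind fun u => some (!u)
  | .and b c => (b.eval W S s).bind fun u => (c.eval W S s).bind fun v => some (u && v)

/-- Number of elementary operations in the evaluation of an integer expression. -/
def IExpr.cost : IExpr → ℕ
  | .const _ => 1
  | .cell a => a.cost + 1
  | .color a => a.cost + 1
  | .add a b => a.cost + b.cost + 1
  | .sub a b => a.cost + b.cost + 1
  | .half a => a.cost + 1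

/-- Number of elementary operations in the evaluation of a real expression. -/
def RExpr.cost : RExpr → ℕ
  | .const _ => 1
  | .cell a => a.cost + 1
  | .x a => a.cost + 1
  | .y a => a.cost + 1
  | .add a b => a.cost + b.cost + 1
  | .sub a b => a.cost + b.cost + 1

/-- Number of elementary operations in the evaluation of a test. -/
def BExpr.cost : BExpr → ℕ
  | .ilt a b => a.cost + b.cost + 1
  | .rlt a b => a.cost + b.cost + 1
  | .not b => b.cost + 1
  | .and b c => b.cost + c.cost + 1

/-- `Exec W S c s t s'`: started in state `s`, the program `c` halts in state `s'` after `t`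
elementary operations, where words hold the integers `0, …, W` and only the integer cells and the
real cells with addresses below `S` can be used. A run that overflows, uses an illegal
address, or does not halt is not an execution. -/
inductive Exec {n k : ℕ} (W S : ℕ) : Cmd → RamState n k → ℕ → RamState n k → Prop
  | skip (s : RamState n k) : Exec W S .skip s 1 s
  | setI {a e : IExpr} {s : RamState n k} {i v : ℕ}
      (ha : a.eval W S s = some i) (hi : i < S) (he : e.eval W S s = some v) :
      Exec W S (.setI a e) s (a.cost + e.cost + 1) { s with imem := Function.update s.imem i v }
  | setR {a : IExpr} {e : RExpr} {s : RamState n k} {i : ℕ} {v : ℝ}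
      (ha : a.eval W S s = some i) (hi : i < S) (he : e.eval W S s = some v) :
      Exec W S (.setR a e) s (a.cost + e.cost + 1) { s with rmem := Function.update s.rmem i v }
  | swap {a b : IExpr} {s : RamState n k} {i j : Fin n}
      (ha : a.eval W S s = some (i : ℕ)) (hb : b.eval W S s = some (j : ℕ)) :
      Exec W S (.swap a b) s (a.cost + b.cost + 1) { s with pts := s.pts ∘ Equiv.swap i j }
  | seq {c d : Cmd} {s s₁ s₂ : RamState n k} {t₁ t₂ : ℕ}
      (hc : Exec W S c s t₁ s₁) (hd : Exec W S d s₁ t₂ s₂) :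
      Exec W S (.seq c d) s (t₁ + t₂) s₂
  | ite_true {b : BExpr} {c d : Cmd} {s s₁ : RamState n k} {t : ℕ}
      (hb : b.eval W S s = some true) (hc : Exec W S c s t s₁) :
      Exec W S (.ite b c d) s (b.cost + 1 + t) s₁
  | ite_false {b : BExpr} {c d : Cmd} {s s₁ : RamState n k} {t : ℕ}
      (hb : b.eval W S s = some false) (hd : Exec W S d s t s₁) :
      Exec W S (.ite b c d) s (b.cost + 1 + t) s₁
  | while_true {b : BExpr} {c : Cmd} {s s₁ s₂ : RamState n k} {t₁ t₂ : ℕ}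
      (hb : b.eval W S s = some true) (hc : Exec W S c s t₁ s₁)
      (hw : Exec W S (.while b c) s₁ t₂ s₂) :
      Exec W S (.while b c) s (b.cost + 1 + t₁ + t₂) s₂
  | while_false {b : BExpr} {c : Cmd} {s : RamState n k}
      (hb : b.eval W S s = some false) :
      Exec W S (.while b c) s (b.cost + 1) s

/-- The initial state: the points are in the input array, integer cells `0` and `1` hold `n` and
`k`, and all other cells are zero. -/
def initState {n k : ℕ} (P : Fin n → ColoredPoint k) : RamState n k where
  imem := fun i => if i = 0 then n else if i = 1 then k else 0
  rmem := fun _ => 0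
  pts := P

/-- The outer rectangle of the output is read off from real cells `0, …, 3`. -/
def outputOuter {n k : ℕ} (s : RamState n k) : Rect := ⟨s.rmem 0, s.rmem 1, s.rmem 2, s.rmem 3⟩

/-- The inner rectangle of the output is read off from real cells `4, …, 7`. -/
def outputInner {n k : ℕ} (s : RamState n k) : Rect := ⟨s.rmem 4, s.rmem 5, s.rmem 6, s.rmem 7⟩

/-! ### Evaluation of expressions and total-correctness rules with a time bound -/

/-! Call the distance of a point of a rectangle from the nearest of the four sides its depth. A
point lies in an annulus of width `w` exactly when it lies in the outer rectangle at depth at most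
`w`. Shrinking the outer rectangle to the bounding box of one such point per color moves the sides
towards these points and increases none of their depths, so only rectangles with sides through input
points matter (`exists_not_noImprovement`).

Conversely, suppose that in such a rectangle every color has a point at depth less than `w`. Let
`w'` be the largest depth below `w`, or zero if none is positive. Every color then has a point at
depth at most `w'`. Moreover `w'` is zero or the depth of an interior point, so `2 * w'` is at most
each side length, and an annulus of width `w' < w` exists (`ImproveInv.spans`). A degenerate side
forces width zero and may be enlarged (`Spans.isCSRA`).

The program sorts the array in place by ordinate, keeps the best width `w`, and runs through the `n
^ 3` triples (left, right, bottom). For a fixed triple, two pointers and one counter per color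
decide in linear time whether some top side allows an improvement (`runs_sweepLoop`). If none does,
the triple is finished for good, since `w` only decreases (`NoImprovement.anti`). Otherwise `w` is
lowered in linear time (`runs_improveCmd`) and the same triple is swept again. Every recorded width
is a difference of two coordinates, so there are at most `2 * n ^ 2` improvements (`diffCount_lt`).
The total is `O(n ^ 4)`; the logarithm in the claimed bound is not needed.
`isMinWidthCSRA_of_search` turns the final state into optimality. -/

/-- The integer cell with a fixed address. -/
abbrev ivar (a : ℕ) : IExpr := .cell (.const a)

/-- The real cell with a fixed address. -/
abbrev rvar (a : ℕ) : RExpr := .cell (.const a)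

namespace ColoredPoint

variable {n k : ℕ}

/-- Abscissas of an array of points, as a total function of the index. -/
def xs (P : Fin n → ColoredPoint k) (i : ℕ) : ℝ := if h : i < n then (P ⟨i, h⟩).x else 0

/-- Ordinates of an array of points, as a total function of the index. -/
def ys (P : Fin n → ColoredPoint k) (i : ℕ) : ℝ := if h : i < n then (P ⟨i, h⟩).y else 0

/-- Colors of an array of points, as a total function of the index. -/
def cs (P : Fin n → ColoredPoint k) (i : ℕ) : ℕ := if h : i < n then (P ⟨i, h⟩).color else 0

theorem cs_lt (P : Fin n → ColoredPoint k) {i : ℕ} (hi : i < n) : cs P i < k := by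
  simp [cs, hi]

end ColoredPoint

open ColoredPoint

section Eval

variable {n k W S : ℕ} {s : RamState n k}

@[simp] theorem toWord_of_le {v : ℕ} (h : v ≤ W) : toWord W v = some v := if_pos h

@[simp] theorem IExpr.eval_const (c : ℕ) :
    (IExpr.const c).eval W S s = toWord W c := by simp [IExpr.eval]

theorem IExpr.eval_cell (a : IExpr) : (IExpr.cell a).eval W S s =
    (a.eval W S s).bind fun i => if i < S then some (s.imem i) else none := by simp [IExpr.eval]

theorem IExpr.eval_cell_of_lt {a : IExpr} {i : ℕ} (h : a.eval W S s = some i) (hi : i < S) :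
    (IExpr.cell a).eval W S s = some (s.imem i) := by simp [IExpr.eval_cell, h, hi]

@[simp] theorem IExpr.eval_ivar {a : ℕ} (h : a ≤ W) (h' : a < S) :
    (IExpr.cell (.const a)).eval W S s = some (s.imem a) :=
  IExpr.eval_cell_of_lt (by simp [h]) h'

@[simp] theorem RExpr.eval_rvar {a : ℕ} (h : a ≤ W) (h' : a < S) :
    (RExpr.cell (.const a)).eval W S s = some (s.rmem a) := by
  simp [RExpr.eval, h, h']

@[simp] theorem RExpr.eval_const (c : ℕ) :
    (RExpr.const c).eval W S s = some (c : ℝ) := by simp [RExpr.eval]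

theorem IExpr.eval_color_of_lt {a : IExpr} {i : ℕ} (h : a.eval W S s = some i) (hi : i < n)
    (hk : k ≤ W) : (IExpr.color a).eval W S s = some (cs s.pts i) := by
  have : ((s.pts ⟨i, hi⟩).color : ℕ) ≤ W := (Fin.is_lt _).le.trans hk
  simp [IExpr.eval, h, hi, cs, this]

theorem RExpr.eval_x_of_lt {a : IExpr} {i : ℕ} (h : a.eval W S s = some i) (hi : i < n) :
    (RExpr.x a).eval W S s = some (xs s.pts i) := by simp [RExpr.eval, h, hi, xs]

theorem RExpr.eval_y_of_lt {a : IExpr} {i : ℕ} (h : a.eval W S s = some i) (hi : i < n) :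
    (RExpr.y a).eval W S s = some (ys s.pts i) := by simp [RExpr.eval, h, hi, ys]

@[simp] theorem RExpr.eval_x_ivar {a : ℕ} (h : a ≤ W) (h' : a < S) (hi : s.imem a < n) :
    (RExpr.x (.cell (.const a))).eval W S s = some (xs s.pts (s.imem a)) :=
  RExpr.eval_x_of_lt (IExpr.eval_ivar h h') hi

@[simp] theorem RExpr.eval_y_ivar {a : ℕ} (h : a ≤ W) (h' : a < S) (hi : s.imem a < n) :
    (RExpr.y (.cell (.const a))).eval W S s = some (ys s.pts (s.imem a)) :=
  RExpr.eval_y_of_lt (IExpr.eval_ivar h h') hi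

@[simp] theorem IExpr.eval_add (a b : IExpr) : (IExpr.add a b).eval W S s =
    (a.eval W S s).bind fun u => (b.eval W S s).bind fun v => toWord W (u + v) := by
  simp [IExpr.eval]

@[simp] theorem IExpr.eval_sub (a b : IExpr) : (IExpr.sub a b).eval W S s =
    (a.eval W S s).bind fun u => (b.eval W S s).bind fun v => some (u - v) := by
  simp [IExpr.eval]

@[simp] theorem RExpr.eval_add (a b : RExpr) : (RExpr.add a b).eval W S s =
    (a.eval W S s).bind fun u => (b.eval W S s).bind fun v => some (u + v) := by
  simp [RExpr.eval]

@[simp] theorem RExpr.eval_sub (a b : RExpr) : (RExpr.sub a b).eval W S s =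
    (a.eval W S s).bind fun u => (b.eval W S s).bind fun v => some (u - v) := by
  simp [RExpr.eval]

/-- The ordinate of the entry just below the one that a cell points to. -/
abbrev yPred (a : ℕ) : RExpr := .y (.sub (ivar a) (.const 1))

@[simp] theorem RExpr.eval_yPred {a : ℕ} (h1 : 1 ≤ W) (h : a ≤ W) (h' : a < S)
    (hi : s.imem a - 1 < n) :
    (RExpr.y (.sub (.cell (.const a)) (.const 1))).eval W S s = some (ys s.pts (s.imem a - 1)) :=
  RExpr.eval_y_of_lt (by simp [h1, h, h']) hi

end Eval

/-! ### Hoare-style rules for total correctness with a time bound. -/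

section Runs

variable {n k : ℕ} (W S : ℕ)

/-- Started in state `s`, the program `c` halts after at most `T` elementary operations in a state
that satisfies `Q`. -/
def Runs (c : Cmd) (s : RamState n k) (T : ℕ) (Q : RamState n k → Prop) : Prop :=
  ∃ t s', Exec W S c s t s' ∧ t ≤ T ∧ Q s'

/-- A bound for the running time of a program without loops. -/
def Cmd.bound : Cmd → ℕ
  | .skip => 1
  | .setI a e => a.cost + e.cost + 1
  | .setR a e => a.cost + e.cost + 1
  | .swap a b => a.cost + b.cost + 1
  | .seq c d => c.bound + d.bound
  | .ite b c d => b.cost + 1 + max c.bound d.bound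
  | .while b _ => b.cost + 1

variable {W S} {s : RamState n k} {c d : Cmd} {b : BExpr} {T T' : ℕ} {Q Q' : RamState n k → Prop}

namespace Runs

theorem mono (h : Runs W S c s T Q) (hT : T ≤ T') (hQ : ∀ s', Q s' → Q' s') :
    Runs W S c s T' Q' := by
  obtain ⟨t, s', he, ht, hq⟩ := h
  exact ⟨t, s', he, ht.trans hT, hQ s' hq⟩

theorem skip (h : Q s) : Runs W S .skip s Cmd.skip.bound Q := ⟨_, _, .skip s, le_rfl, h⟩

theorem setI {a e : IExpr} {i v : ℕ} (ha : a.eval W S s = some i) (hi : i < S)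
    (he : e.eval W S s = some v) (h : Q { s with imem := Function.update s.imem i v }) :
    Runs W S (.setI a e) s (Cmd.setI a e).bound Q := ⟨_, _, .setI ha hi he, le_rfl, h⟩

theorem setR {a : IExpr} {e : RExpr} {i : ℕ} {v : ℝ} (ha : a.eval W S s = some i) (hi : i < S)
    (he : e.eval W S s = some v) (h : Q { s with rmem := Function.update s.rmem i v }) :
    Runs W S (.setR a e) s (Cmd.setR a e).bound Q := ⟨_, _, .setR ha hi he, le_rfl, h⟩

theorem swap {a a' : IExpr} {i j : Fin n} (ha : a.eval W S s = some (i : ℕ))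
    (hb : a'.eval W S s = some (j : ℕ)) (h : Q { s with pts := s.pts ∘ Equiv.swap i j }) :
    Runs W S (.swap a a') s (Cmd.swap a a').bound Q := ⟨_, _, .swap ha hb, le_rfl, h⟩

theorem seq' (h : Runs W S c s T fun s₁ => Runs W S d s₁ T' Q) :
    Runs W S (.seq c d) s (T + T') Q := by
  obtain ⟨t, s₁, he, ht, t', s₂, he', ht', hq⟩ := h
  exact ⟨_, _, .seq he he', add_le_add ht ht', hq⟩

theorem seq (h : Runs W S c s c.bound fun s₁ => Runs W S d s₁ d.bound Q) :
    Runs W S (.seq c d) s (Cmd.seq c d).bound Q := seq' h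

theorem ite' {v : Bool} (hb : b.eval W S s = some v) (h₁ : v = true → Runs W S c s T Q)
    (h₂ : v = false → Runs W S d s T' Q) :
    Runs W S (.ite b c d) s (b.cost + 1 + max T T') Q := by
  cases v with
  | true =>
    obtain ⟨t, s', he, ht, hq⟩ := h₁ rfl
    exact ⟨_, _, .ite_true hb he, by omega, hq⟩
  | false =>
    obtain ⟨t, s', he, ht, hq⟩ := h₂ rfl
    exact ⟨_, _, .ite_false hb he, by omega, hq⟩

theorem ite {p : Prop} [Decidable p] (hb : b.eval W S s = some (decide p))
    (h₁ : p → Runs W S c s c.bound Q) (h₂ : ¬p → Runs W S d s d.bound Q) :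
    Runs W S (.ite b c d) s (Cmd.ite b c d).bound Q :=
  ite' hb (fun h => h₁ (of_decide_eq_true h)) fun h => h₂ (of_decide_eq_false h)

/-- The rule for loops: an invariant `I` and a potential `μ` that decreases in every iteration. -/
theorem while' (p : RamState n k → Prop) [DecidablePred p] (I : RamState n k → Prop)
    (μ : RamState n k → ℕ)
    (hb : ∀ s, I s → b.eval W S s = some (decide (p s)))
    (hc : ∀ s, I s → p s → Runs W S c s T fun s' => I s' ∧ μ s' < μ s)
    (h : I s) :
    Runs W S (.while b c) s ((b.cost + 1 + T) * μ s + (b.cost + 1)) fun s' => I s' ∧ ¬ p s' := by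
  induction hm : μ s using Nat.strong_induction_on generalizing s with
  | _ m ih =>
    by_cases hp : p s
    · obtain ⟨t, s₁, he, ht, hI, hlt⟩ := hc s h hp
      obtain ⟨t', s₂, he', ht', hq⟩ := ih _ (hm ▸ hlt) hI rfl
      refine ⟨_, s₂, .while_true (by simpa [hp] using hb s h) he he', ?_, hq⟩
      obtain ⟨m', rfl⟩ : ∃ m', m = m' + 1 := ⟨m - 1, by omega⟩
      have : (b.cost + 1 + T) * μ s₁ ≤ (b.cost + 1 + T) * m' := Nat.mul_le_mul_left _ (by omega)
      have : (b.cost + 1 + T) * (m' + 1) = (b.cost + 1 + T) * m' + (b.cost + 1 + T) := by ring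
      omega
    · exact ⟨_, s, .while_false (by simpa [hp] using hb s h), by omega, h, hp⟩

end Runs

end Runs

/-! ### Rectangles spanned by four coordinates of the points -/

section Geometry

variable {n k : ℕ}

/-- `(x, y)` lies in the region with sides `l`, `r`, `b` that is unbounded above. -/
def InStrip (l r b x y : ℝ) : Prop := l ≤ x ∧ x ≤ r ∧ b ≤ y

/-- `(x, y)` is at distance less than `w` from one of the sides `l`, `r`, `b`. -/
def NearSides (l r b w x y : ℝ) : Prop := x - l < w ∨ r - x < w ∨ y - b < w

/-- The points with index at most `z` do not span all colors by points of the rectangle with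
sides `l`, `r`, `b`, `ys P z` at distance less than `w` from its boundary. -/
def NoImprovement (P : Fin n → ColoredPoint k) (l r b w : ℝ) (z : ℕ) : Prop :=
  ∃ c < k, ∀ p ≤ z, cs P p = c → InStrip l r b (xs P p) (ys P p) →
    ¬ (NearSides l r b w (xs P p) (ys P p) ∨ ys P z - ys P p < w)

/-- This is why a rejected triple stays rejected after later improvements of the width. -/
theorem NoImprovement.anti {P : Fin n → ColoredPoint k} {l r b w w' : ℝ} {z : ℕ}
    (h : NoImprovement P l r b w z) (hw : w' ≤ w) : NoImprovement P l r b w' z := by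
  obtain ⟨c, hc, h⟩ := h
  refine ⟨c, hc, fun p hp hcp hs hn => h p hp hcp hs ?_⟩
  rcases hn with (h | h | h) | h
  · exact .inl (.inl (h.trans_le hw))
  · exact .inl (.inr (.inl (h.trans_le hw)))
  · exact .inl (.inr (.inr (h.trans_le hw)))
  · exact .inr (h.trans_le hw)

/-- The points are sorted by their ordinates. -/
def SortedByY (P : Fin n → ColoredPoint k) : Prop :=
  ∀ i j, i ≤ j → j < n → ys P i ≤ ys P j

/-- Every color has a point in the rectangle with sides `l`, `r`, `b`, `t` at distance at most `w`
from its boundary, and the rectangle admits an annulus of width `w`. -/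
structure Spans (P : Fin n → ColoredPoint k) (l r b t w : ℝ) : Prop where
  width_nonneg : 0 ≤ w
  two_width_le_length : 2 * w ≤ r - l
  two_width_le_height : 2 * w ≤ t - b
  exists_point : ∀ c < k, ∃ p < n, cs P p = c ∧ InStrip l r b (xs P p) (ys P p) ∧ ys P p ≤ t ∧
    (xs P p - l ≤ w ∨ r - xs P p ≤ w ∨ ys P p - b ≤ w ∨ t - ys P p ≤ w)

/-- If some rectangle spans all colors at width `w' < w`, then so does one whose sides pass through
points, at a width less than `w`. -/
theorem exists_not_noImprovement {P : Fin n → ColoredPoint k} (hk : 0 < k)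
    {l r b t w' w : ℝ} (hw : w' < w)
    (h : ∀ c < k, ∃ p < n, cs P p = c ∧ InStrip l r b (xs P p) (ys P p) ∧ ys P p ≤ t ∧
      (xs P p - l ≤ w' ∨ r - xs P p ≤ w' ∨ ys P p - b ≤ w' ∨ t - ys P p ≤ w')) :
    ∃ i < n, ∃ j < n, ∃ m < n, ∃ z < n, ¬ NoImprovement P (xs P i) (xs P j) (ys P m) w z := by
  choose! f hf using h
  -- The new sides are those of the bounding box of the representatives `f c`; each side moves
  -- inwards, so no representative gets deeper.
  have hne : (Finset.range k).Nonempty := ⟨0, by simpa using hk⟩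
  obtain ⟨c₁, hc₁, h₁⟩ := Finset.exists_min_image (Finset.range k) (fun c => xs P (f c)) hne
  obtain ⟨c₂, hc₂, h₂⟩ := Finset.exists_max_image (Finset.range k) (fun c => xs P (f c)) hne
  obtain ⟨c₃, hc₃, h₃⟩ := Finset.exists_min_image (Finset.range k) (fun c => ys P (f c)) hne
  -- The top is chosen by largest index, not largest ordinate: `NoImprovement` looks only at indices
  -- up to `z`, which matters when ordinates tie.
  obtain ⟨c₄, hc₄, h₄⟩ := Finset.exists_max_image (Finset.range k) f hne
  simp only [Finset.mem_range] at hc₁ hc₂ hc₃ hc₄ h₁ h₂ h₃ h₄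
  refine ⟨f c₁, (hf _ hc₁).1, f c₂, (hf _ hc₂).1, f c₃, (hf _ hc₃).1, f c₄, (hf _ hc₄).1, ?_⟩
  rintro ⟨c, hc, hno⟩
  refine hno (f c) (h₄ c hc) (hf c hc).2.1 ⟨h₁ c hc, h₂ c hc, h₃ c hc⟩ ?_
  have e₁ := (hf _ hc₁).2.2.1.1
  have e₂ := (hf _ hc₂).2.2.1.2.1
  have e₃ := (hf _ hc₃).2.2.1.2.2
  have e₄ := (hf _ hc₄).2.2.2.1
  rcases (hf c hc).2.2.2.2 with h | h | h | h
  · exact .inl (.inl (by linarith))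
  · exact .inl (.inr (.inl (by linarith)))
  · exact .inl (.inr (.inr (by linarith)))
  · exact .inr (by linarith)

theorem exists_index {P : Fin n → ColoredPoint k} {c : ℕ} (hc : c < k) :
    (∃ i, (P i).color = ⟨c, hc⟩) ↔ ∃ p < n, cs P p = c := by
  constructor
  · rintro ⟨i, hi⟩
    exact ⟨i, i.2, by simp [cs, hi]⟩
  · rintro ⟨p, hp, h⟩
    refine ⟨⟨p, hp⟩, Fin.ext ?_⟩
    simpa [cs, hp] using h

/-- The common center and the equal offsets place each inner side exactly one width inside the outer
one, so failing to be strictly inside the inner rectangle means being within one width of some outer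
side. -/
theorem IsCSRA.exists_point {P : Fin n → ColoredPoint k} {R R' : Rect} (h : IsCSRA P R R') :
    ∀ c < k, ∃ p < n, cs P p = c ∧ InStrip R.left R.right R.bottom (xs P p) (ys P p) ∧
      ys P p ≤ R.top ∧ (xs P p - R.left ≤ annulusWidth R R' ∨ R.right - xs P p ≤ annulusWidth R R' ∨
        ys P p - R.bottom ≤ annulusWidth R R' ∨ R.top - ys P p ≤ annulusWidth R R') := by
  intro c hc
  obtain ⟨i, hi, ⟨h₁, h₂, h₃, h₄⟩, hn⟩ := h.2 ⟨c, hc⟩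
  refine ⟨i, i.2, by simp [cs, hi], ⟨by simpa [xs] using h₁, by simpa [xs] using h₂,
    by simpa [ys] using h₃⟩, by simpa [ys] using h₄, ?_⟩
  obtain ⟨-, -, -, -, hx, hy, ho, -⟩ := h.1
  simp only [Rect.MemInterior, annulusWidth, Rect.length, Rect.height, xs, ys, i.2, dif_pos,
    Fin.eta] at hn hx hy ho ⊢
  by_contra! hcon
  obtain ⟨q₁, q₂, q₃, q₄⟩ := hcon
  exact hn ⟨by linarith, by linarith, by linarith, by linarith⟩

theorem IsCSRA.annulusWidth_nonneg {P : Fin n → ColoredPoint k} {R R' : Rect}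
    (h : IsCSRA P R R') : 0 ≤ annulusWidth R R' := by
  have := h.1.inner_le_outer
  simp only [annulusWidth]
  linarith

/-- The upper end of an interval, enlarged if the interval is degenerate. -/
noncomputable def properRight (l r : ℝ) : ℝ := if l < r then r else l + 1

/-- The rectangle found by the search, with degenerate sides enlarged. -/
noncomputable def outerRect (l r b t : ℝ) : Rect := ⟨l, properRight l r, b, properRight b t⟩

/-- The inner rectangle of the annulus of width `w`. -/
noncomputable def innerRect (l r b t w : ℝ) : Rect :=
  ⟨l + w, properRight l r - w, b + w, properRight b t - w⟩

theorem annulusWidth_outerRect (l r b t w : ℝ) :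
    annulusWidth (outerRect l r b t) (innerRect l r b t w) = w := by
  simp only [annulusWidth, outerRect, innerRect, Rect.length]
  ring

/-- If a side is degenerate, then `w = 0` and all relevant points lie on that side. Moving the
opposite side away makes the rectangle proper and leaves these points on its boundary. -/
theorem Spans.isCSRA {P : Fin n → ColoredPoint k} {l r b t w : ℝ} (h : Spans P l r b t w) :
    IsCSRA P (outerRect l r b t) (innerRect l r b t w) := by
  obtain ⟨h0, hl, hh, hp⟩ := h
  have hr : l < properRight l r ∧ r ≤ properRight l r ∧ (properRight l r = r ∨ w = 0 ∧ l = r) := by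
    unfold properRight
    split_ifs with hlt
    · exact ⟨hlt, le_rfl, .inl rfl⟩
    · exact ⟨by linarith, by linarith, .inr ⟨by linarith, by linarith⟩⟩
  have ht : b < properRight b t ∧ t ≤ properRight b t ∧ (properRight b t = t ∨ w = 0 ∧ b = t) := by
    unfold properRight
    split_ifs with hlt
    · exact ⟨hlt, le_rfl, .inl rfl⟩
    · exact ⟨by linarith, by linarith, .inr ⟨by linarith, by linarith⟩⟩
  simp only [outerRect, innerRect]
  generalize properRight l r = r' at *
  generalize properRight b t = t' at *
  obtain ⟨r₁, r₂, r₃⟩ := hr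
  obtain ⟨t₁, t₂, t₃⟩ := ht
  refine ⟨⟨?_, ?_, ?_, ?_, ?_, ?_, ?_, ?_⟩, fun c => ?_⟩
  any_goals simp only [Rect.length, Rect.height]; linarith
  obtain ⟨p, hpn, hc, ⟨s₁, s₂, s₃⟩, s₄, hs⟩ := hp c c.2
  refine ⟨⟨p, hpn⟩, Fin.ext (by simpa [cs, hpn] using hc), ?_⟩
  simp only [xs, ys, hpn, dif_pos] at s₁ s₂ s₃ s₄ hs
  refine ⟨⟨s₁, s₂.trans r₂, s₃, s₄.trans t₂⟩, ?_⟩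
  rintro ⟨q₁, q₂, q₃, q₄⟩
  simp only at q₁ q₂ q₃ q₄
  rcases r₃ with rfl | ⟨rfl, rfl⟩ <;> rcases t₃ with rfl | ⟨r₃, rfl⟩ <;> try linarith
  rcases hs with h | h | h | h <;> linarith

theorem IsCSRA.comp_perm {P : Fin n → ColoredPoint k} {R R' : Rect} (h : IsCSRA P R R')
    (σ : Equiv.Perm (Fin n)) : IsCSRA (P ∘ σ) R R' := by
  refine ⟨h.1, fun c => ?_⟩
  obtain ⟨i, hi⟩ := h.2 c
  exact ⟨σ.symm i, by simpa using hi⟩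

theorem IsMinWidthCSRA.of_comp_perm {P : Fin n → ColoredPoint k} {R R' : Rect}
    {σ : Equiv.Perm (Fin n)} (h : IsMinWidthCSRA (P ∘ σ) R R') : IsMinWidthCSRA P R R' := by
  refine ⟨?_, fun C C' hC => h.2 C C' (hC.comp_perm σ)⟩
  have := h.1.comp_perm σ.symm
  rwa [Function.comp_assoc, Equiv.self_comp_symm] at this

/-- The search over all rectangles ends with an optimal annulus. -/
theorem isMinWidthCSRA_of_search {P : Fin n → ColoredPoint k} (hP : SortedByY P) (hk : 0 < k)
    (hsurj : ∀ c < k, ∃ p < n, cs P p = c) {l r b t w : ℝ}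
    (hs : w = ys P (n - 1) - ys P 0 + 1 ∨ Spans P l r b t w)
    (hno : w ≤ 0 ∨ ∀ i < n, ∀ j < n, ∀ m < n, ∀ z < n,
      NoImprovement P (xs P i) (xs P j) (ys P m) w z) :
    IsMinWidthCSRA P (outerRect l r b t) (innerRect l r b t w) := by
  have key : ∀ {l r b t w' : ℝ}, w' < w → 0 ≤ w' →
      (∀ c < k, ∃ p < n, cs P p = c ∧ InStrip l r b (xs P p) (ys P p) ∧ ys P p ≤ t ∧
      (xs P p - l ≤ w' ∨ r - xs P p ≤ w' ∨ ys P p - b ≤ w' ∨ t - ys P p ≤ w')) → False := by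
    intro l r b t w' h₁ h₀ h₂
    rcases hno with h | h
    · linarith
    · obtain ⟨i, hi, j, hj, m, hm, z, hz, hc⟩ := exists_not_noImprovement hk h₁ h₂
      exact hc (h i hi j hj m hm z hz)
  have hs' : Spans P l r b t w := by
    refine hs.resolve_left fun hw0 => ?_
    obtain ⟨p, hp, -⟩ := hsurj 0 hk
    have hle := hP 0 (n - 1) (Nat.zero_le _) (by omega)
    obtain ⟨M, hM⟩ := ((Finset.range n).image (xs P)).exists_le
    obtain ⟨M', hM'⟩ := ((Finset.range n).image (fun i => - xs P i)).exists_le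
    -- If the initial width had survived, a box around all points would contradict `key`: its height
    -- is one less than the initial width, and every point is within that height of the bottom.
    refine key (l := -M') (r := M) (b := ys P 0) (t := ys P (n - 1)) (w' := ys P (n - 1) - ys P 0)
      (by linarith) (by linarith) fun c hc => ?_
    obtain ⟨p, hp, hpc⟩ := hsurj c hc
    have h1 := hM (xs P p) (Finset.mem_image_of_mem _ (by simpa using hp))
    have h2 := hM' (- xs P p)
      (Finset.mem_image_of_mem (fun i => - xs P i) (Finset.mem_range.2 hp))
    have h3 := hP 0 p (Nat.zero_le _) hp
    have h4 := hP p (n - 1) (by omega) (by omega)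
    exact ⟨p, hp, hpc, ⟨by linarith, h1, h3⟩, h4, .inr (.inr (.inl (by linarith)))⟩
  refine ⟨hs'.isCSRA, fun C C' hC => ?_⟩
  rw [annulusWidth_outerRect]
  by_contra! hlt
  exact key hlt hC.annulusWidth_nonneg hC.exists_point

/-! ### The number of coordinate differences below a bound -/

/-- The number of coordinate differences below `w`. -/
noncomputable def diffCount (P : Fin n → ColoredPoint k) (w : ℝ) : ℕ :=
  open Classical in
  ((Finset.range n ×ˢ Finset.range n).filter fun a => xs P a.1 - xs P a.2 < w).card +
  ((Finset.range n ×ˢ Finset.range n).filter fun a => ys P a.1 - ys P a.2 < w).card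

theorem diffCount_le (P : Fin n → ColoredPoint k) (w : ℝ) : diffCount P w ≤ 2 * n ^ 2 := by
  classical
  have h : (Finset.range n ×ˢ Finset.range n).card = n ^ 2 := by simp [sq]
  refine (add_le_add (Finset.card_filter_le _ _) (Finset.card_filter_le _ _)).trans ?_
  rw [h]
  omega

/-- `w` is the difference of two abscissas or of two ordinates. -/
def IsDiff (P : Fin n → ColoredPoint k) (w : ℝ) : Prop :=
  ∃ i < n, ∃ j < n, w = xs P i - xs P j ∨ w = ys P i - ys P j

theorem card_filter_lt_le {α : Type*} (s : Finset α) (f : α → ℝ) {w w' : ℝ} (h : w' ≤ w) :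
    open Classical in (s.filter fun a => f a < w').card ≤ (s.filter fun a => f a < w).card := by
  classical
  exact Finset.card_le_card fun a => by
    simp only [Finset.mem_filter]
    exact fun ha => ⟨ha.1, ha.2.trans_le h⟩

theorem card_filter_lt_lt {α : Type*} (s : Finset α) (f : α → ℝ) {w w' : ℝ} (h : w' < w)
    (ha : ∃ a ∈ s, w' = f a) :
    open Classical in (s.filter fun a => f a < w').card < (s.filter fun a => f a < w).card := by
  classical
  obtain ⟨a, ha, rfl⟩ := ha
  refine Finset.card_lt_card (Finset.ssubset_iff.2 ⟨a, by simp, fun a' => ?_⟩)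
  simp only [Finset.mem_insert, Finset.mem_filter]
  rintro (rfl | ⟨h₁, h₂⟩)
  · exact ⟨ha, h⟩
  · exact ⟨h₁, h₂.trans h⟩

/-- The pair realizing `w'` is counted below `w` but not below `w'`. This bounds the number of
improvements. -/
theorem diffCount_lt {P : Fin n → ColoredPoint k} {w w' : ℝ} (h : w' < w) (hd : IsDiff P w') :
    diffCount P w' < diffCount P w := by
  obtain ⟨i, hi, j, hj, hij⟩ := hd
  have hm : (i, j) ∈ Finset.range n ×ˢ Finset.range n := by simp [hi, hj]
  rcases hij with hij | hij
  · exact add_lt_add_of_lt_of_le (card_filter_lt_lt _ _ h ⟨_, hm, hij⟩)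
      (card_filter_lt_le _ _ h.le)
  · exact add_lt_add_of_le_of_lt (card_filter_lt_le _ _ h.le)
      (card_filter_lt_lt _ _ h ⟨_, hm, hij⟩)

end Geometry

/-! ### Sorting the input array -/

section Sorting

variable {n k W S : ℕ}

/-- Compare the entries that cells `2` and `3` point to, and put the lower one first. -/
def sortSwap : Cmd := .ite (.rlt (.y (ivar 3)) (.y (ivar 2))) (.swap (ivar 2) (ivar 3)) .skip

def sortBody : Cmd :=
  .ite (.ilt (ivar 3) (ivar 0))
    (.seq sortSwap (.setI (.const 3) (.add (ivar 3) (.const 1))))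
    (.seq (.setI (.const 2) (.add (ivar 2) (.const 1))) (.setI (.const 3) (ivar 2)))

/-- Exchange sort by ordinates. -/
def sortCmd : Cmd := .while (.ilt (ivar 2) (ivar 0)) sortBody

theorem ys_comp_swap (P : Fin n → ColoredPoint k) {i j : ℕ} (hi : i < n) (hj : j < n) (a : ℕ) :
    ys (P ∘ Equiv.swap ⟨i, hi⟩ ⟨j, hj⟩) a =
      if a = i then ys P j else if a = j then ys P i else ys P a := by
  by_cases ha : a < n
  · have h : ∀ b (hb : b < n), ys P b = (P ⟨b, hb⟩).y := fun b hb => by simp [ys, hb]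
    rw [h i hi, h j hj, h a ha]
    simp only [ys, ha, dif_pos, Function.comp, Equiv.swap_apply_def, Fin.mk.injEq]
    split_ifs <;> rfl
  · have : a ≠ i := by omega
    have : a ≠ j := by omega
    simp [ys, *]

/-- The state during the sorting. -/
structure SortInv (P : Fin n → ColoredPoint k) (s : RamState n k) : Prop where
  cell_n : s.imem 0 = n
  cell_k : s.imem 1 = k
  perm : ∃ σ : Equiv.Perm (Fin n), s.pts = P ∘ σ
  outer_le : s.imem 2 ≤ s.imem 3
  inner_le : s.imem 3 ≤ n
  prefix_le : ∀ a < s.imem 2, ∀ b, a ≤ b → b < n → ys s.pts a ≤ ys s.pts b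
  pivot_le : ∀ b, s.imem 2 ≤ b → b < s.imem 3 → ys s.pts (s.imem 2) ≤ ys s.pts b

/-- The weight `n + 1` outweighs the reset of the inner index, which gives back at most `n`. -/
def sortPotential (s : RamState n k) : ℕ :=
  (n - s.imem 2) * (n + 1) + (n - s.imem 3)

theorem runs_sortSwap {P : Fin n → ColoredPoint k} {s : RamState n k} (hW : 32 ≤ W) (hS : 32 ≤ S)
    (h : SortInv P s) (hj : s.imem 3 < n) :
    Runs W S sortSwap s sortSwap.bound fun s' => SortInv P s' ∧ s'.imem = s.imem ∧
      ys s'.pts (s'.imem 2) ≤ ys s'.pts (s'.imem 3) := by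
  have h1 := h.outer_le
  have hi : s.imem 2 < n := by omega
  refine Runs.ite (p := ys s.pts (s.imem 3) < ys s.pts (s.imem 2)) ?_ (fun hlt => ?_) fun hlt => ?_
  · simp (disch := omega) [BExpr.eval]
  · refine Runs.swap (i := ⟨_, hi⟩) (j := ⟨_, hj⟩) (by simp (disch := omega))
      (by simp (disch := omega)) ⟨⟨h.cell_n, h.cell_k, ?_, h.outer_le, h.inner_le, ?_, ?_⟩, rfl, ?_⟩
    · obtain ⟨σ, hσ⟩ := h.perm
      exact ⟨(Equiv.swap ⟨_, hi⟩ ⟨_, hj⟩).trans σ, by simp [hσ, Function.comp_assoc]⟩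
    · intro a ha b hab hb
      simp only at ha
      have e₁ := h.prefix_le a ha
      simp only [ys_comp_swap]
      rw [if_neg (by omega), if_neg (by omega)]
      split_ifs
      · exact e₁ _ (by omega) hj
      · exact e₁ _ (by omega) hi
      · exact e₁ _ hab hb
    · intro b hb hbj
      simp only at hb hbj
      have e₁ := h.pivot_le b hb hbj
      simp only [ys_comp_swap, if_pos]
      split_ifs
      · exact le_rfl
      · exact hlt.le
      · exact hlt.le.trans e₁
    · simp only [ys_comp_swap, if_pos]
      split_ifs
      · exact le_rfl
      · exact hlt.le
  · exact Runs.skip ⟨h, rfl, not_lt.1 hlt⟩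

theorem runs_sortBody {P : Fin n → ColoredPoint k} {s : RamState n k} (hW : 32 * n ≤ W)
    (hS : 32 ≤ S) (h : SortInv P s) (hi : s.imem 2 < n) :
    Runs W S sortBody s sortBody.bound fun s' =>
      SortInv P s' ∧ sortPotential s' < sortPotential s := by
  have h1 := h.outer_le
  have h2 := h.inner_le
  have h0 := h.cell_n
  refine Runs.ite (p := s.imem 3 < n) ?_ (fun hj => ?_) fun hj => ?_
  · simp (disch := omega) [BExpr.eval, h0]
  · refine Runs.seq ((runs_sortSwap (by omega) hS h hj).mono le_rfl ?_)
    rintro s₁ ⟨I, he, hle⟩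
    rw [← he] at hi hj h1 h2 h0
    refine Runs.setI (i := 3) (v := s₁.imem 3 + 1) (by simp (disch := omega)) (by omega)
      (by simp (disch := omega)) ⟨⟨?_, ?_, I.perm, ?_, ?_, ?_, ?_⟩, ?_⟩
    · simpa using I.cell_n
    · simpa using I.cell_k
    · simp; omega
    · simp; omega
    · simpa using I.prefix_le
    · simp only [Function.update_self, ne_eq, Nat.reduceEqDiff, not_false_eq_true,
        Function.update_of_ne]
      intro b hb hb'
      rcases Nat.lt_succ_iff_lt_or_eq.1 hb' with hb' | rfl
      · exact I.pivot_le b hb hb'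
      · exact hle
    · simp [sortPotential, ← he]; omega
  · refine Runs.seq (Runs.setI (i := 2) (v := s.imem 2 + 1) (by simp (disch := omega)) (by omega)
      (by simp (disch := omega)) ?_)
    refine Runs.setI (i := 3) (v := s.imem 2 + 1) (by simp (disch := omega)) (by omega)
      (by simp (disch := omega)) ⟨⟨?_, ?_, h.perm, ?_, ?_, ?_, ?_⟩, ?_⟩
    · simpa using h.cell_n
    · simpa using h.cell_k
    · simp
    · simp; omega
    · simp only [ne_eq, Nat.reduceEqDiff, not_false_eq_true, Function.update_of_ne,
        Function.update_self]
      intro a ha b hab hb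
      rcases Nat.lt_succ_iff_lt_or_eq.1 ha with ha | rfl
      · exact h.prefix_le a ha b hab hb
      -- The inner index has reached `n`, so the pivot is minimal among all remaining entries.
      · exact h.pivot_le b hab (by omega)
    · simp
      intro b hb hb'
      omega
    · simp [sortPotential]
      obtain ⟨d, hd⟩ : ∃ d, n - s.imem 2 = d + 1 := ⟨n - s.imem 2 - 1, by omega⟩
      rw [hd, show n - (s.imem 2 + 1) = d by omega, Nat.add_mul]
      omega

theorem runs_sortCmd (P : Fin n → ColoredPoint k) (hW : 32 * n ≤ W) (hS : 32 ≤ S) (hn : 0 < n) :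
    Runs W S sortCmd (initState P) ((6 + sortBody.bound) * (n * (n + 1) + n) + 6) fun s' =>
      s'.imem 0 = n ∧ s'.imem 1 = k ∧ (∃ σ : Equiv.Perm (Fin n), s'.pts = P ∘ σ) ∧
      SortedByY s'.pts := by
  have I : SortInv P (initState P) := by
    refine ⟨rfl, rfl, ⟨Equiv.refl _, rfl⟩, ?_, ?_, ?_, ?_⟩ <;> simp [initState]
  refine (Runs.while' (fun s => s.imem 2 < n) (SortInv P) sortPotential (fun s h => ?_)
    (fun s h hi => runs_sortBody hW hS h hi) I).mono ?_ fun s' h => ?_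
  · have := h.cell_n
    simp (disch := omega) [BExpr.eval, this]
  · simp [sortPotential, initState, BExpr.cost, IExpr.cost]
  · refine ⟨h.1.cell_n, h.1.cell_k, h.1.perm, fun a b hab hb => h.1.prefix_le a ?_ b hab hb⟩
    have := h.2
    omega

end Sorting

/-! ### Counting the points of every color in the annulus -/

section Counting

variable {n k W S : ℕ}

open Classical in
/-- The number of entries of color `c` below `q` in the strip that either have index at least `u`
or are near one of the three fixed sides. -/
noncomputable def activeCount (P : Fin n → ColoredPoint k) (l r b w : ℝ) (q u c : ℕ) : ℕ :=
  ((Finset.range q).filter fun p => cs P p = c ∧ InStrip l r b (xs P p) (ys P p) ∧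
    (u ≤ p ∨ NearSides l r b w (xs P p) (ys P p))).card

open Classical in
theorem activeCount_le (P : Fin n → ColoredPoint k) (l r b w : ℝ) (q u c : ℕ) :
    activeCount P l r b w q u c ≤ q :=
  (Finset.card_filter_le _ _).trans_eq (Finset.card_range q)

theorem activeCount_ne_zero {P : Fin n → ColoredPoint k} {l r b w : ℝ} {q u c : ℕ} :
    activeCount P l r b w q u c ≠ 0 ↔ ∃ p < q, cs P p = c ∧ InStrip l r b (xs P p) (ys P p) ∧
      (u ≤ p ∨ NearSides l r b w (xs P p) (ys P p)) := by
  simp only [activeCount, ne_eq, Finset.card_eq_zero, Finset.filter_eq_empty_iff,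
    Finset.mem_range, not_forall, not_not, exists_prop]

open Classical in
theorem activeCount_add_one (P : Fin n → ColoredPoint k) (l r b w : ℝ) {q u : ℕ} (h : u ≤ q)
    (c : ℕ) : activeCount P l r b w (q + 1) u c = activeCount P l r b w q u c +
      if cs P q = c ∧ InStrip l r b (xs P q) (ys P q) then 1 else 0 := by
  simp only [activeCount, Finset.range_add_one, Finset.filter_insert, h, true_or, and_true]
  split_ifs
  · rw [Finset.card_insert_of_notMem (by simp)]
  · rfl

-- When the tail passes `u`, that entry stops counting unless one of the three fixed sides keeps it
-- active.
open Classical in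
theorem activeCount_eq_add (P : Fin n → ColoredPoint k) (l r b w : ℝ) {q u : ℕ} (h : u < q)
    (c : ℕ) : activeCount P l r b w q u c = activeCount P l r b w q (u + 1) c +
      if cs P u = c ∧ InStrip l r b (xs P u) (ys P u) ∧ ¬ NearSides l r b w (xs P u) (ys P u)
      then 1 else 0 := by
  have e : (if cs P u = c ∧ InStrip l r b (xs P u) (ys P u) ∧
      ¬ NearSides l r b w (xs P u) (ys P u) then 1 else 0) =
      ∑ p ∈ Finset.range q, if p = u then (if cs P p = c ∧ InStrip l r b (xs P p) (ys P p) ∧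
        ¬ NearSides l r b w (xs P p) (ys P p) then 1 else 0) else 0 := by
    rw [Finset.sum_ite_eq', if_pos (Finset.mem_range.2 h)]
  rw [e, activeCount, activeCount, Finset.card_filter, Finset.card_filter,
    ← Finset.sum_add_distrib]
  refine Finset.sum_congr rfl fun p _ => ?_
  rcases lt_trichotomy p u with hp | rfl | hp
  · have h₁ : ¬ u ≤ p := by omega
    have h₂ : ¬ u + 1 ≤ p := by omega
    have h₃ : p ≠ u := by omega
    simp [h₁, h₂, h₃]
  · by_cases hn : NearSides l r b w (xs P p) (ys P p) <;> simp [hn]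
  · have h₁ : u ≤ p := by omega
    have h₂ : u + 1 ≤ p := by omega
    have h₃ : p ≠ u := by omega
    simp [h₁, h₂, h₃]

/-- The number of nonzero values among the first `k`. -/
def numPos (k : ℕ) (f : ℕ → ℕ) : ℕ := ((Finset.range k).filter fun c => f c ≠ 0).card

theorem numPos_le (k : ℕ) (f : ℕ → ℕ) : numPos k f ≤ k :=
  (Finset.card_filter_le _ _).trans_eq (Finset.card_range k)

/-- Only the term of `c₀` can change. The additive form avoids truncated subtraction and serves both
increments and decrements. -/
theorem numPos_change {f g : ℕ → ℕ} {c₀ : ℕ} (hc : c₀ < k) (h : ∀ c ≠ c₀, g c = f c) :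
    numPos k g + (if f c₀ = 0 then 0 else 1) = numPos k f + if g c₀ = 0 then 0 else 1 := by
  have hm : c₀ ∈ Finset.range k := Finset.mem_range.2 hc
  unfold numPos
  rw [Finset.card_filter, Finset.card_filter, ← Finset.sum_erase_add _ _ hm,
    ← Finset.sum_erase_add _ _ hm, Finset.sum_congr rfl (g := fun c => if f c ≠ 0 then 1 else 0)]
  · split_ifs <;> simp_all
  · intro c hc
    rw [h c (Finset.ne_of_mem_erase hc)]

theorem le_numPos_iff {f : ℕ → ℕ} : k ≤ numPos k f ↔ ∀ c < k, f c ≠ 0 := by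
  constructor
  · intro h c hc
    have : (Finset.range k).filter (fun c => f c ≠ 0) = Finset.range k :=
      Finset.eq_of_subset_of_card_le (Finset.filter_subset _ _) (by simpa [numPos] using h)
    have hc' := Finset.mem_range.2 hc
    rw [← this] at hc'
    exact (Finset.mem_filter.1 hc').2
  · intro h
    unfold numPos
    rw [Finset.filter_true_of_mem fun c hc => h c (Finset.mem_range.1 hc), Finset.card_range]

end Counting

/-! ### The sweep for fixed left, right and bottom sides -/

section Sweep

variable {n k W S : ℕ}

/-- Memory layout from here on. Integer cells `2`, `3`, `4` point to the entries giving the left,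
right and bottom sides; `5` is one past the top entry; `6` is the tail; `7` is the number of colors
with nonzero counter; `8` is the sweep status (0 running, 1 improvement found, 2 exhausted); `9` is
a loop index; the counter of color `c` is at `16 + c`. Real cells `0` to `3` hold the best
rectangle, `8` the best width, `9` the width being computed and `10` a depth. -/
abbrev leftX : RExpr := .x (ivar 2)
abbrev rightX : RExpr := .x (ivar 3)
abbrev bottomY : RExpr := .y (ivar 4)

/-- The address of the counter of the color of the entry that cell `a` points to. -/
abbrev colorAddr (a : ℕ) : IExpr := .add (.const 16) (.color (ivar a))

def addCount : Cmd :=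
  .seq (.ite (.ilt (.cell (colorAddr 5)) (.const 1)) (.setI (.const 7) (.add (ivar 7) (.const 1)))
      .skip)
    (.setI (colorAddr 5) (.add (.cell (colorAddr 5)) (.const 1)))

def removeCount : Cmd :=
  .seq (.setI (colorAddr 6) (.sub (.cell (colorAddr 6)) (.const 1)))
    (.ite (.ilt (.cell (colorAddr 6)) (.const 1)) (.setI (.const 7) (.sub (ivar 7) (.const 1)))
      .skip)

def inStripTest : BExpr :=
  .and (.not (.rlt (.x (ivar 5)) leftX))
    (.and (.not (.rlt rightX (.x (ivar 5)))) (.not (.rlt (.y (ivar 5)) bottomY)))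

/-- No test for the strip is needed: a point at distance at least `w > 0` inwards from the three
sides is in it. -/
def farTest : BExpr :=
  .and (.not (.rlt (.sub (.x (ivar 6)) leftX) (rvar 8)))
    (.and (.not (.rlt (.sub rightX (.x (ivar 6))) (rvar 8)))
      (.not (.rlt (.sub (.y (ivar 6)) bottomY) (rvar 8))))

def addPoint : Cmd :=
  .seq (.ite inStripTest addCount .skip) (.setI (.const 5) (.add (ivar 5) (.const 1)))

def removePoint : Cmd :=
  .seq (.ite farTest removeCount .skip) (.setI (.const 6) (.add (ivar 6) (.const 1)))

/-- The tail catches up before the colors are counted, so the counters are read only when they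
describe exactly the points at depth less than the width for the current top. -/
def sweepBody : Cmd :=
  .ite (.not (.rlt (.sub (yPred 5) (.y (ivar 6))) (rvar 8))) removePoint
    (.ite (.not (.ilt (ivar 7) (ivar 1))) (.setI (.const 8) (.const 1))
      (.ite (.ilt (ivar 5) (ivar 0)) addPoint (.setI (.const 8) (.const 2))))

def sweepLoop : Cmd := .while (.ilt (ivar 8) (.const 1)) sweepBody

/-- `s'` differs from `s` only in integer cells with address at least `5`. -/
structure SameSearch (s s' : RamState n k) : Prop where
  pts : s'.pts = s.pts
  rmem : s'.rmem = s.rmem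
  imem : ∀ a < 5, s'.imem a = s.imem a

/-- The indices that determine the sides of the current rectangle are legal. -/
structure SearchOk (W S : ℕ) (s : RamState n k) : Prop where
  words : 32 * n ≤ W
  cells : 32 * k ≤ S
  colors_pos : 0 < k
  colors_le : k ≤ n
  cell_n : s.imem 0 = n
  cell_k : s.imem 1 = k
  left_lt : s.imem 2 < n
  right_lt : s.imem 3 < n
  bottom_lt : s.imem 4 < n
  sorted : SortedByY s.pts
  width_pos : 0 < s.rmem 8

theorem SearchOk.of_same {s s' : RamState n k} (h : SearchOk W S s) (hs : SameSearch s s') :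
    SearchOk W S s' := by
  obtain ⟨h1, h2, h3, h4, h5, h6, h7, h8, h9, h10, h11⟩ := h
  obtain ⟨e1, e2, e3⟩ := hs
  refine ⟨h1, h2, h3, h4, ?_, ?_, ?_, ?_, ?_, ?_, ?_⟩ <;> simp [*]

section sides
variable (s : RamState n k)
noncomputable abbrev sideL : ℝ := xs s.pts (s.imem 2)
noncomputable abbrev sideR : ℝ := xs s.pts (s.imem 3)
noncomputable abbrev sideB : ℝ := ys s.pts (s.imem 4)
noncomputable abbrev curW : ℝ := s.rmem 8
end sides

/-- The counters are correct for the window from `u` to `q`. -/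
structure Counts (s : RamState n k) (q u : ℕ) : Prop where
  count : ∀ c < k, s.imem (16 + c) =
    activeCount s.pts (sideL s) (sideR s) (sideB s) (curW s) q u c
  num : s.imem 7 = numPos k fun c => s.imem (16 + c)

theorem runs_addCount {s : RamState n k} (h : SearchOk W S s) (hq : s.imem 5 < n)
    {q u : ℕ} (hc : Counts s q u) (hqn : q ≤ n) :
    Runs W S addCount s addCount.bound fun s' => SameSearch s s' ∧ s'.imem 5 = s.imem 5 ∧
      s'.imem 6 = s.imem 6 ∧ s'.imem 8 = s.imem 8 ∧
      s'.imem 7 = numPos k (fun c => s'.imem (16 + c)) ∧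
      ∀ c, s'.imem (16 + c) = s.imem (16 + c) + if cs s.pts (s.imem 5) = c then 1 else 0 := by
  obtain ⟨h1, h2, h3, h4, -⟩ := h
  have hck := cs_lt s.pts hq
  have hcnt := hc.count _ hck
  have hcle := activeCount_le s.pts (sideL s) (sideR s) (sideB s) (curW s) q u
    (cs s.pts (s.imem 5))
  have hnum := hc.num
  have hnle := numPos_le k fun c => s.imem (16 + c)
  rw [← hcnt] at hcle
  rw [← hnum] at hnle
  have hA : (colorAddr 5).eval W S s = some (16 + cs s.pts (s.imem 5)) := by
    rw [IExpr.eval_add, IExpr.eval_color_of_lt (i := s.imem 5) (by simp (disch := omega)) hq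
      (by omega)]
    simp (disch := omega)
  refine Runs.seq (Runs.ite (p := s.imem (16 + cs s.pts (s.imem 5)) < 1) ?_ (fun hp => ?_)
    fun hp => ?_)
  · rw [BExpr.eval, IExpr.eval_cell_of_lt hA (by omega)]
    simp (disch := omega)
  · refine Runs.setI (i := 7) (v := s.imem 7 + 1) (by simp (disch := omega)) (by omega)
      (by simp (disch := omega)) ?_
    have hA' : (colorAddr 5).eval W S ({ s with imem := Function.update s.imem 7 (s.imem 7 + 1) } :
        RamState n k) = some (16 + cs s.pts (s.imem 5)) := by
      rw [IExpr.eval_add, IExpr.eval_color_of_lt (i := s.imem 5) (by simp (disch := omega)) hq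
        (by omega)]
      simp (disch := omega)
    refine Runs.setI hA' (by omega) (v := s.imem (16 + cs s.pts (s.imem 5)) + 1) ?_
      ⟨⟨rfl, rfl, ?_⟩, ?_, ?_, ?_, ?_, ?_⟩
    · rw [IExpr.eval_add, IExpr.eval_cell_of_lt hA' (by omega)]
      simp (disch := omega) [Function.update_of_ne]
    · intro a ha
      simp (disch := omega) [Function.update_of_ne]
    · simp (disch := omega) [Function.update_of_ne]
    · simp (disch := omega) [Function.update_of_ne]
    · simp (disch := omega) [Function.update_of_ne]
    · have := numPos_change (k := k) (f := fun c => s.imem (16 + c)) (g := fun c =>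
        (Function.update (Function.update s.imem 7 (s.imem 7 + 1)) (16 + cs s.pts (s.imem 5))
          (s.imem (16 + cs s.pts (s.imem 5)) + 1)) (16 + c)) hck (fun c hc => by
            simp (disch := omega) [Function.update_of_ne])
      simp (disch := omega) [Function.update_of_ne] at this ⊢
      rw [if_pos (by omega)] at this
      omega
    · intro c
      by_cases hcc : cs s.pts (s.imem 5) = c
      · simp [hcc]
      · simp (disch := omega) [Function.update_of_ne, hcc]
  · refine Runs.skip ?_
    refine Runs.setI hA (by omega) (v := s.imem (16 + cs s.pts (s.imem 5)) + 1) ?_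
      ⟨⟨rfl, rfl, ?_⟩, ?_, ?_, ?_, ?_, ?_⟩
    · rw [IExpr.eval_add, IExpr.eval_cell_of_lt hA (by omega)]
      simp (disch := omega)
    · intro a ha
      simp (disch := omega) [Function.update_of_ne]
    · simp (disch := omega) [Function.update_of_ne]
    · simp (disch := omega) [Function.update_of_ne]
    · simp (disch := omega) [Function.update_of_ne]
    · have := numPos_change (k := k) (f := fun c => s.imem (16 + c)) (g := fun c =>
        (Function.update s.imem (16 + cs s.pts (s.imem 5))
          (s.imem (16 + cs s.pts (s.imem 5)) + 1)) (16 + c)) hck (fun c hc => by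
            simp (disch := omega) [Function.update_of_ne])
      simp (disch := omega) [Function.update_of_ne] at this ⊢
      rw [if_neg (by omega)] at this
      omega
    · intro c
      by_cases hcc : cs s.pts (s.imem 5) = c
      · simp [hcc]
      · simp (disch := omega) [Function.update_of_ne, hcc]

/-- The counter is tested after the decrement; `hpos` makes the truncated subtraction exact. -/
theorem runs_removeCount {s : RamState n k} (h : SearchOk W S s) (hu : s.imem 6 < n)
    {q u : ℕ} (hc : Counts s q u) (hpos : s.imem (16 + cs s.pts (s.imem 6)) ≠ 0) :
    Runs W S removeCount s removeCount.bound fun s' => SameSearch s s' ∧ s'.imem 5 = s.imem 5 ∧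
      s'.imem 6 = s.imem 6 ∧ s'.imem 8 = s.imem 8 ∧
      s'.imem 7 = numPos k (fun c => s'.imem (16 + c)) ∧
      ∀ c, s.imem (16 + c) = s'.imem (16 + c) + if cs s.pts (s.imem 6) = c then 1 else 0 := by
  obtain ⟨h1, h2, h3, h4, -⟩ := h
  have hck := cs_lt s.pts hu
  have hnum := hc.num
  have hnle := numPos_le k fun c => s.imem (16 + c)
  rw [← hnum] at hnle
  have hA : (colorAddr 6).eval W S s = some (16 + cs s.pts (s.imem 6)) := by
    rw [IExpr.eval_add, IExpr.eval_color_of_lt (i := s.imem 6) (by simp (disch := omega)) hu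
      (by omega)]
    simp (disch := omega)
  refine Runs.seq (Runs.setI hA (by omega) (v := s.imem (16 + cs s.pts (s.imem 6)) - 1) ?_ ?_)
  · rw [IExpr.eval_sub, IExpr.eval_cell_of_lt hA (by omega)]
    simp (disch := omega)
  have hA' : (colorAddr 6).eval W S ({ s with imem := (Function.update s.imem
      (16 + cs s.pts (s.imem 6)) (s.imem (16 + cs s.pts (s.imem 6)) - 1)) } : RamState n k) =
      some (16 + cs s.pts (s.imem 6)) := by
    rw [IExpr.eval_add, IExpr.eval_color_of_lt (i := s.imem 6)
      (by simp (disch := omega) [Function.update_of_ne]) hu (by omega)]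
    simp (disch := omega)
  have key := numPos_change (k := k) (f := fun c => s.imem (16 + c)) (g := fun c =>
    (Function.update s.imem (16 + cs s.pts (s.imem 6))
      (s.imem (16 + cs s.pts (s.imem 6)) - 1)) (16 + c)) hck (fun c hc => by
        simp (disch := omega) [Function.update_of_ne])
  rw [if_neg hpos] at key
  refine Runs.ite (p := s.imem (16 + cs s.pts (s.imem 6)) - 1 < 1) ?_ (fun hp => ?_)
    fun hp => ?_
  · rw [BExpr.eval, IExpr.eval_cell_of_lt hA' (by omega)]
    simp (disch := omega)
  · refine Runs.setI (i := 7) (v := s.imem 7 - 1)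
      (by simp (disch := omega)) (by omega)
      (by simp (disch := omega) [Function.update_of_ne]) ⟨⟨rfl, rfl, ?_⟩, ?_, ?_, ?_, ?_, ?_⟩
    · intro a ha
      simp (disch := omega) [Function.update_of_ne]
    · simp (disch := omega) [Function.update_of_ne]
    · simp (disch := omega) [Function.update_of_ne]
    · simp (disch := omega) [Function.update_of_ne]
    · simp (disch := omega) [Function.update_of_ne] at key ⊢
      omega
    · intro c
      by_cases hcc : cs s.pts (s.imem 6) = c
      · subst hcc
        simp (disch := omega) [Function.update_of_ne]
        omega
      · simp (disch := omega) [Function.update_of_ne, hcc]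
  · refine Runs.skip ⟨⟨rfl, rfl, ?_⟩, ?_, ?_, ?_, ?_, ?_⟩
    · intro a ha
      simp (disch := omega) [Function.update_of_ne]
    · simp (disch := omega) [Function.update_of_ne]
    · simp (disch := omega) [Function.update_of_ne]
    · simp (disch := omega) [Function.update_of_ne]
    · simp (disch := omega) [Function.update_of_ne] at key ⊢
      rw [if_neg (by omega)] at key
      omega
    · intro c
      by_cases hcc : cs s.pts (s.imem 6) = c
      · subst hcc
        simp (disch := omega)
      · simp (disch := omega) [Function.update_of_ne, hcc]

end Sweep

/-! ### Correctness and linear running time of the two-pointer sweep. -/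

section SweepLoop

variable {n k W S : ℕ}

theorem SameSearch.refl (s : RamState n k) : SameSearch s s := ⟨rfl, rfl, fun _ _ => rfl⟩

theorem SameSearch.trans {s s' s'' : RamState n k} (h : SameSearch s s') (h' : SameSearch s' s'') :
    SameSearch s s'' :=
  ⟨h'.pts.trans h.pts, h'.rmem.trans h.rmem, fun a ha => (h'.imem a ha).trans (h.imem a ha)⟩

theorem SameSearch.update (s : RamState n k) {a : ℕ} (ha : 5 ≤ a) (v : ℕ) :
    SameSearch s { s with imem := Function.update s.imem a v } :=
  ⟨rfl, rfl, fun a' ha' => by simp (disch := omega) [Function.update_of_ne]⟩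

section
variable {s s' : RamState n k} (h : SameSearch s s')
include h
theorem SameSearch.sideL_eq : sideL s' = sideL s := by
  simp [sideL, h.pts, h.imem 2 (by omega)]
theorem SameSearch.sideR_eq : sideR s' = sideR s := by
  simp [sideR, h.pts, h.imem 3 (by omega)]
theorem SameSearch.sideB_eq : sideB s' = sideB s := by
  simp [sideB, h.pts, h.imem 4 (by omega)]
theorem SameSearch.curW_eq : curW s' = curW s := by
  simp [curW, h.rmem]
end

/-- No improvement with the current three sides and top side through the entry `z`. -/
def NoImprovementAt (s : RamState n k) (z : ℕ) : Prop :=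
  NoImprovement s.pts (sideL s) (sideR s) (sideB s) (curW s) z

theorem SameSearch.noImprovementAt_iff {s s' : RamState n k} (h : SameSearch s s') {z : ℕ} :
    NoImprovementAt s' z ↔ NoImprovementAt s z := by
  rw [NoImprovementAt, NoImprovementAt, h.sideL_eq, h.sideR_eq, h.sideB_eq, h.curW_eq, h.pts]

/-- The sweep has found a rectangle that improves on the current width. -/
def Improves (s : RamState n k) : Prop :=
  0 < s.imem 5 ∧ ∀ c < k, ∃ p < s.imem 5, cs s.pts p = c ∧
    InStrip (sideL s) (sideR s) (sideB s) (xs s.pts p) (ys s.pts p) ∧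
    (NearSides (sideL s) (sideR s) (sideB s) (curW s) (xs s.pts p) (ys s.pts p) ∨
      ys s.pts (s.imem 5 - 1) - ys s.pts p < curW s)

/-- The state during the sweep. -/
structure SweepInv (s : RamState n k) : Prop where
  top_le : s.imem 5 ≤ n
  tail_le : s.imem 6 ≤ s.imem 5 - 1
  tail_far : ∀ p < s.imem 6, curW s ≤ ys s.pts (s.imem 5 - 1) - ys s.pts p
  counts : Counts s (s.imem 5) (s.imem 6)
  past : ∀ z, z + 1 < s.imem 5 → NoImprovementAt s z
  found : s.imem 8 = 0 ∨ (s.imem 8 = 1 ∧ Improves s) ∨ (s.imem 8 = 2 ∧ ∀ z < n, NoImprovementAt s z)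

/-- Each iteration advances the tail, advances the top or ends the sweep, whence at most `2 * n + 1`
iterations. -/
def sweepPotential (s : RamState n k) : ℕ :=
  (1 - s.imem 8) + (n - s.imem 5) + (n - s.imem 6)

theorem Counts.of_change {s s' : RamState n k} (h : SameSearch s s') {q u : ℕ}
    (hc : ∀ c < k, s'.imem (16 + c) =
      activeCount s.pts (sideL s) (sideR s) (sideB s) (curW s) q u c)
    (hn : s'.imem 7 = numPos k fun c => s'.imem (16 + c)) : Counts s' q u :=
  ⟨by rw [h.pts, h.sideL_eq, h.sideR_eq, h.sideB_eq, h.curW_eq]; exact hc, hn⟩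

theorem Counts.update {s : RamState n k} {q u a : ℕ} (h : Counts s q u) (h5 : 5 ≤ a) (h7 : a ≠ 7)
    (h16 : a < 16) (v : ℕ) : Counts { s with imem := Function.update s.imem a v } q u :=
  Counts.of_change (SameSearch.update s h5 v)
    (fun c hc => by
      have := h.count c hc
      simpa (disch := omega) [Function.update_of_ne])
    (by
      have := h.num
      simpa (disch := omega) [Function.update_of_ne])

open Classical in
theorem runs_addPoint {s : RamState n k} (h : SearchOk W S s) (hq : s.imem 5 < n)
    (hu : s.imem 6 ≤ s.imem 5) (hc : Counts s (s.imem 5) (s.imem 6)) :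
    Runs W S addPoint s addPoint.bound fun s' => SameSearch s s' ∧ s'.imem 5 = s.imem 5 + 1 ∧
      s'.imem 6 = s.imem 6 ∧ s'.imem 8 = s.imem 8 ∧ Counts s' (s.imem 5 + 1) (s.imem 6) := by
  have hW := h.words
  have hS := h.cells
  have hk := h.colors_pos
  have h2 := h.left_lt
  have h3 := h.right_lt
  have h4 := h.bottom_lt
  have hcount := fun c => activeCount_add_one s.pts (sideL s) (sideR s) (sideB s) (curW s) hu c
  refine Runs.seq (Runs.mono (Q := fun s' => SameSearch s s' ∧ s'.imem 5 = s.imem 5 ∧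
      s'.imem 6 = s.imem 6 ∧ s'.imem 8 = s.imem 8 ∧ Counts s' (s.imem 5 + 1) (s.imem 6))
      (Runs.ite (p := InStrip (sideL s) (sideR s) (sideB s) (xs s.pts (s.imem 5))
      (ys s.pts (s.imem 5))) ?_ (fun hp => ?_) fun hp => ?_) le_rfl ?_)
  · simp (disch := omega) only [inStripTest, BExpr.eval, RExpr.eval_x_ivar, RExpr.eval_y_ivar,
      Option.bind_some, ← decide_not, not_lt, ← Bool.decide_and]
    exact congrArg some (decide_eq_decide.2 Iff.rfl)
  · refine (runs_addCount h hq hc hq.le).mono le_rfl ?_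
    rintro s' ⟨e, e5, e6, e8, e7, ec⟩
    refine ⟨e, e5, e6, e8, Counts.of_change e (fun c hck => ?_) e7⟩
    rw [ec, hc.count c hck, hcount]
    simp [hp]
  · refine Runs.skip ⟨SameSearch.refl s, rfl, rfl, rfl, fun c hck => ?_, hc.num⟩
    rw [hc.count c hck, hcount]
    simp [hp]
  · rintro s₁ ⟨e, e5, e6, e8, ec⟩
    refine Runs.setI (i := 5) (v := s.imem 5 + 1) (by simp (disch := omega)) (by omega)
      (by simp (disch := omega) [e5]) ⟨e.trans (.update s₁ le_rfl _), ?_, ?_, ?_,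
        ec.update le_rfl (by omega) (by omega) _⟩
    · simp
    · simpa using e6
    · simpa using e8

open Classical in
theorem runs_removePoint {s : RamState n k} (h : SearchOk W S s) (hq : s.imem 5 ≤ n)
    (hu : s.imem 6 < s.imem 5) (hc : Counts s (s.imem 5) (s.imem 6)) :
    Runs W S removePoint s removePoint.bound fun s' => SameSearch s s' ∧ s'.imem 5 = s.imem 5 ∧
      s'.imem 6 = s.imem 6 + 1 ∧ s'.imem 8 = s.imem 8 ∧
      Counts s' (s.imem 5) (s.imem 6 + 1) := by
  have hW := h.words
  have hS := h.cells
  have hk := h.colors_pos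
  have h2 := h.left_lt
  have h3 := h.right_lt
  have h4 := h.bottom_lt
  have hw := h.width_pos
  have hcount := fun c => activeCount_eq_add s.pts (sideL s) (sideR s) (sideB s) (curW s) hu c
  have hfar : (InStrip (sideL s) (sideR s) (sideB s) (xs s.pts (s.imem 6)) (ys s.pts (s.imem 6)) ∧
      ¬ NearSides (sideL s) (sideR s) (sideB s) (curW s) (xs s.pts (s.imem 6))
        (ys s.pts (s.imem 6))) ↔
      curW s ≤ xs s.pts (s.imem 6) - sideL s ∧ curW s ≤ sideR s - xs s.pts (s.imem 6) ∧
        curW s ≤ ys s.pts (s.imem 6) - sideB s := by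
    simp only [NearSides, InStrip, not_or, not_lt]
    constructor
    · exact fun h => h.2
    · exact fun h => ⟨⟨by linarith, by linarith, by linarith⟩, h⟩
  refine Runs.seq (Runs.mono (Q := fun s' => SameSearch s s' ∧ s'.imem 5 = s.imem 5 ∧
      s'.imem 6 = s.imem 6 ∧ s'.imem 8 = s.imem 8 ∧ Counts s' (s.imem 5) (s.imem 6 + 1))
      (Runs.ite (p := curW s ≤ xs s.pts (s.imem 6) - sideL s ∧
        curW s ≤ sideR s - xs s.pts (s.imem 6) ∧
        curW s ≤ ys s.pts (s.imem 6) - sideB s) ?_ (fun hp => ?_) fun hp => ?_) le_rfl ?_)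
  · have h6 : s.imem 6 < n := by omega
    simp (disch := omega) only [farTest, BExpr.eval, RExpr.eval_sub, RExpr.eval_x_ivar,
      RExpr.eval_y_ivar, RExpr.eval_rvar, Option.bind_some, ← decide_not, not_lt, ← Bool.decide_and]
  · have hck := cs_lt s.pts (i := s.imem 6) (by omega)
    refine (runs_removeCount h (by omega) hc ?_).mono le_rfl ?_
    · rw [hc.count _ hck, activeCount_ne_zero]
      exact ⟨_, hu, rfl, (hfar.2 hp).1, .inl le_rfl⟩
    rintro s' ⟨e, e5, e6, e8, e7, ec⟩
    refine ⟨e, e5, e6, e8, Counts.of_change e (fun c hck => ?_) e7⟩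
    have := ec c
    rw [hc.count c hck, hcount] at this
    simp only [hfar, hp, and_self, and_true] at this
    omega
  · refine Runs.skip ⟨SameSearch.refl s, rfl, rfl, rfl, fun c hck => ?_, hc.num⟩
    rw [hc.count c hck, hcount, if_neg (fun h => hp (hfar.1 h.2)), add_zero]
  · rintro s₁ ⟨e, e5, e6, e8, ec⟩
    refine Runs.setI (i := 6) (v := s.imem 6 + 1) (by simp (disch := omega)) (by omega)
      (by simp (disch := omega) [e6]) ⟨e.trans (.update s₁ (by omega) _), ?_, ?_, ?_,
        ec.update (by omega) (by omega) (by omega) _⟩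
    · simpa using e5
    · simp
    · simpa using e8

/-- The entries counted as active are those in the rectangle at distance less than the width. -/
theorem SweepInv.active_iff {s : RamState n k} (h : SearchOk W S s) (I : SweepInv s)
    (hnear : ys s.pts (s.imem 5 - 1) - ys s.pts (s.imem 6) < curW s) {p : ℕ}
    (hp : p < s.imem 5) :
    s.imem 6 ≤ p ↔ ys s.pts (s.imem 5 - 1) - ys s.pts p < curW s := by
  constructor
  · intro hup
    have := h.sorted (s.imem 6) p hup (hp.trans_le I.top_le)
    linarith
  · intro hlt
    by_contra! hc
    have := I.tail_far p hc
    linarith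

/-- Fewer than `k` nonzero counters means that some color has counter zero, and this color is the
witness. -/
theorem SweepInv.noImprovementAt {s : RamState n k} (h : SearchOk W S s) (I : SweepInv s)
    (hnear : ys s.pts (s.imem 5 - 1) - ys s.pts (s.imem 6) < curW s) (hnum : s.imem 7 < k)
    {z : ℕ} (hz : z + 1 = s.imem 5) : NoImprovementAt s z := by
  have hnot : ¬ k ≤ numPos k fun c => s.imem (16 + c) := by rw [← I.counts.num]; omega
  rw [le_numPos_iff] at hnot
  push Not at hnot
  obtain ⟨c, hc, h0⟩ := hnot
  refine ⟨c, hc, fun p hp hpc hs hn => ?_⟩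
  refine activeCount_ne_zero.2 ⟨p, ?_, hpc, hs, ?_⟩ ((I.counts.count c hc).symm.trans h0)
  · omega
  · rw [I.active_iff h hnear (by omega), show s.imem 5 - 1 = z by omega]
    exact hn.symm

theorem runs_sweepBody {s : RamState n k} (h : SearchOk W S s) (I : SweepInv s)
    (h8 : s.imem 8 < 1) :
    Runs W S sweepBody s sweepBody.bound fun s' =>
      (SameSearch s s' ∧ SweepInv s') ∧ sweepPotential s' < sweepPotential s := by
  have hW := h.words
  have hS := h.cells
  have hk := h.colors_pos
  have hkn := h.colors_le
  have hc0 := h.cell_n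
  have hc1 := h.cell_k
  have hw := h.width_pos
  have hq := I.top_le
  have hu := I.tail_le
  have h80 : s.imem 8 = 0 := by omega
  refine Runs.ite (p := ¬ (ys s.pts (s.imem 5 - 1) - ys s.pts (s.imem 6) < curW s)) ?_
    (fun hp => ?_) fun hp => ?_
  · simp (disch := omega) only [BExpr.eval, RExpr.eval_sub, RExpr.eval_yPred,
      RExpr.eval_y_ivar, RExpr.eval_rvar, Option.bind_some, decide_not]
  -- The tail never passes the top entry, whose distance from the top is `0 < w`. This also covers
  -- the start, where `0 - 1 = 0`.
  · have hu' : s.imem 6 < s.imem 5 - 1 := by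
      refine lt_of_le_of_ne hu fun he => hp ?_
      rw [he, sub_self]
      exact hw
    refine (runs_removePoint h hq (by omega) I.counts).mono le_rfl ?_
    rintro s' ⟨e, e5, e6, e8, ec⟩
    refine ⟨⟨e, ?_, ?_, ?_, ?_, ?_, ?_⟩, ?_⟩
    · omega
    · omega
    · intro p hp'
      rw [e.curW_eq, e.pts, e5]
      rcases Nat.lt_succ_iff_lt_or_eq.1 (e6 ▸ hp') with hp' | rfl
      · exact I.tail_far p hp'
      · exact not_lt.1 hp
    · rwa [e5, e6]
    · intro z hz
      rw [e.noImprovementAt_iff]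
      exact I.past z (e5 ▸ hz)
    · exact .inl (e8.trans h80)
    · simp only [sweepPotential, e5, e6, e8]
      omega
  rw [not_not] at hp
  refine Runs.ite (p := ¬ (s.imem 7 < k)) ?_ (fun hk' => ?_) fun hk' => ?_
  · simp (disch := omega) only [BExpr.eval, IExpr.eval_ivar, Option.bind_some, hc1, decide_not]
  · have e : SameSearch s { s with imem := Function.update s.imem 8 1 } :=
      SameSearch.update s (by omega) _
    refine Runs.setI (i := 8) (v := 1) (by simp (disch := omega)) (by omega)
      (by simp (disch := omega)) ⟨⟨e, ?_, ?_, ?_, ?_, ?_, ?_⟩, ?_⟩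
    · simpa using hq
    · simpa using hu
    · rw [e.curW_eq, e.pts]
      simpa using I.tail_far
    · have := I.counts.update (a := 8) (by omega) (by omega) (by omega) 1
      simpa using this
    · intro z hz
      rw [e.noImprovementAt_iff]
      exact I.past z (by simpa using hz)
    · refine .inr (.inl ⟨by simp, ?_⟩)
      rw [Improves, e.curW_eq, e.sideL_eq, e.sideR_eq, e.sideB_eq, e.pts]
      simp only [ne_eq, Nat.reduceEqDiff, not_false_eq_true, Function.update_of_ne]
      have hall := le_numPos_iff.1 (I.counts.num ▸ (not_lt.1 hk'))
      have hex : ∀ c < k, ∃ p < s.imem 5, cs s.pts p = c ∧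
          InStrip (sideL s) (sideR s) (sideB s) (xs s.pts p) (ys s.pts p) ∧
          (NearSides (sideL s) (sideR s) (sideB s) (curW s) (xs s.pts p) (ys s.pts p) ∨
            ys s.pts (s.imem 5 - 1) - ys s.pts p < curW s) := by
        intro c hc
        obtain ⟨p, hp', hpc, hs, hn⟩ := activeCount_ne_zero.1
          ((I.counts.count c hc) ▸ hall c hc)
        refine ⟨p, hp', hpc, hs, ?_⟩
        rw [I.active_iff h hp hp'] at hn
        exact hn.symm
      obtain ⟨p, hp', -⟩ := hex 0 hk
      exact ⟨by omega, hex⟩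
    · simp [sweepPotential, h80]
  rw [not_not] at hk'
  have hno : ∀ z, z < s.imem 5 → NoImprovementAt s z := by
    intro z hz
    rcases Nat.lt_or_ge (z + 1) (s.imem 5) with hlt | hge
    · exact I.past z hlt
    · exact I.noImprovementAt h hp hk' (by omega)
  refine Runs.ite (p := s.imem 5 < n) ?_ (fun hqn => ?_) fun hqn => ?_
  · simp (disch := omega) [BExpr.eval, hc0]
  · refine (runs_addPoint h hqn (by omega) I.counts).mono le_rfl ?_
    rintro s' ⟨e, e5, e6, e8, ec⟩
    refine ⟨⟨e, ?_, ?_, ?_, ?_, ?_, ?_⟩, ?_⟩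
    · omega
    · omega
    · intro p hp'
      rw [e.curW_eq, e.pts, e5, Nat.add_sub_cancel]
      have h1 := I.tail_far p (e6 ▸ hp')
      -- Raising the top only increases the distances of the discarded entries from it.
      have h2 := h.sorted (s.imem 5 - 1) (s.imem 5) (by omega) hqn
      linarith
    · rwa [e5, e6]
    · intro z hz
      rw [e.noImprovementAt_iff]
      exact hno z (by omega)
    · exact .inl (e8.trans h80)
    · simp only [sweepPotential, e5, e6, e8]
      omega
  · have e : SameSearch s { s with imem := Function.update s.imem 8 2 } :=
      SameSearch.update s (by omega) _
    refine Runs.setI (i := 8) (v := 2) (by simp (disch := omega)) (by omega)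
      (by simp (disch := omega)) ⟨⟨e, ?_, ?_, ?_, ?_, ?_, ?_⟩, ?_⟩
    · simpa using hq
    · simpa using hu
    · rw [e.curW_eq, e.pts]
      simpa using I.tail_far
    · have := I.counts.update (a := 8) (by omega) (by omega) (by omega) 2
      simpa using this
    · intro z hz
      rw [e.noImprovementAt_iff]
      exact I.past z (by simpa using hz)
    · refine .inr (.inr ⟨by simp, fun z hz => ?_⟩)
      rw [e.noImprovementAt_iff]
      exact hno z (by omega)
    · simp [sweepPotential, h80]

theorem runs_sweepLoop {s : RamState n k} (h : SearchOk W S s) (I : SweepInv s) :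
    Runs W S sweepLoop s ((5 + sweepBody.bound) * (2 * n + 1) + 5) fun s' => SameSearch s s' ∧
      ((s'.imem 8 = 1 ∧ s'.imem 5 ≤ n ∧ Improves s') ∨
        (s'.imem 8 = 2 ∧ ∀ z < n, NoImprovementAt s z)) := by
  have hW := h.words
  have hS := h.cells
  have hk := h.colors_pos
  have hkn := h.colors_le
  refine (Runs.while' (T := sweepBody.bound) (fun s => s.imem 8 < 1) (fun s' => SameSearch s s' ∧ SweepInv s')
    sweepPotential (fun s' h' => ?_) (fun s' h' h8 => ?_) ⟨SameSearch.refl s, I⟩).mono ?_ ?_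
  · simp (disch := omega) [BExpr.eval]
  · exact (runs_sweepBody (h.of_same h'.1) h'.2 h8).mono le_rfl fun s'' h'' =>
      ⟨⟨h'.1.trans h''.1.1, h''.1.2⟩, h''.2⟩
  · simp only [BExpr.cost, IExpr.cost]
    gcongr
    simp only [sweepPotential]
    omega
  · rintro s' ⟨⟨e, I'⟩, h8⟩
    refine ⟨e, ?_⟩
    rcases I'.found with h0 | h1 | h2
    · omega
    · exact .inl ⟨h1.1, I'.top_le, h1.2⟩
    · exact .inr ⟨h2.1, fun z hz => e.noImprovementAt_iff.1 (h2.2 z hz)⟩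

end SweepLoop

/-! ### Resetting the counters -/

section Reset

variable {n k W S : ℕ}

def clearBody : Cmd :=
  .seq (.setI (.add (.const 16) (ivar 9)) (.const 0)) (.setI (.const 9) (.add (ivar 9) (.const 1)))

def clearPointers : Cmd :=
  .seq (.setI (.const 7) (.const 0)) (.seq (.setI (.const 5) (.const 0))
    (.seq (.setI (.const 6) (.const 0)) (.setI (.const 8) (.const 0))))

def resetCmd : Cmd :=
  .seq (.setI (.const 9) (.const 0)) (.seq (.while (.ilt (ivar 9) (ivar 1)) clearBody) clearPointers)

theorem runs_clearPointers {s : RamState n k} (h : SearchOk W S s)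
    (h0 : ∀ c < k, s.imem (16 + c) = 0) :
    Runs W S clearPointers s clearPointers.bound fun s' => SameSearch s s' ∧ SweepInv s' := by
  have hW := h.words
  have hS := h.cells
  have hk := h.colors_pos
  have hkn := h.colors_le
  refine Runs.seq (Runs.setI (i := 7) (v := 0) (by simp (disch := omega)) (by omega)
    (by simp (disch := omega)) ?_)
  refine Runs.seq (Runs.setI (i := 5) (v := 0) (by simp (disch := omega)) (by omega)
    (by simp (disch := omega)) ?_)
  refine Runs.seq (Runs.setI (i := 6) (v := 0) (by simp (disch := omega)) (by omega)
    (by simp (disch := omega)) ?_)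
  have e : SameSearch s { s with
      imem := Function.update (Function.update (Function.update (Function.update s.imem 7 0) 5 0)
        6 0) 8 0 } :=
    ⟨rfl, rfl, fun a ha => by simp (disch := omega) [Function.update_of_ne]⟩
  refine Runs.setI (i := 8) (v := 0) (by simp (disch := omega)) (by omega)
    (by simp (disch := omega)) ⟨e, ?_, ?_, ?_, ?_, ?_, ?_⟩
  · simp
  · simp
  · simp
  · refine Counts.of_change e (fun c hc => ?_) ?_
    · simp (disch := omega) [Function.update_of_ne, activeCount, h0 c hc]
    · simp only [ne_eq, Nat.reduceEqDiff, not_false_eq_true, Function.update_of_ne,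
        Function.update_self]
      symm
      rw [numPos, Finset.card_eq_zero, Finset.filter_eq_empty_iff]
      intro c hc
      have := h0 c (Finset.mem_range.1 hc)
      simpa (disch := omega) [Function.update_of_ne]
  · simp
  · simp

theorem runs_resetCmd {s : RamState n k} (h : SearchOk W S s) :
    Runs W S resetCmd s (3 + ((6 + clearBody.bound) * n + 6 + clearPointers.bound)) fun s' =>
      SameSearch s s' ∧ SweepInv s' := by
  have hW := h.words
  have hS := h.cells
  have hk := h.colors_pos
  have hkn := h.colors_le
  refine Runs.seq' (T := 3) (Runs.setI (i := 9) (v := 0) (by simp (disch := omega)) (by omega)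
    (by simp (disch := omega)) ?_)
  set s₀ : RamState n k := { s with imem := Function.update s.imem 9 0 } with hs₀
  have e₀ : SameSearch s s₀ := SameSearch.update s (by omega) 0
  refine Runs.seq' ((Runs.while' (T := clearBody.bound) (fun s => s.imem 9 < k)
    (fun s' => SameSearch s s' ∧ s'.imem 9 ≤ k ∧ ∀ c < s'.imem 9, s'.imem (16 + c) = 0)
    (fun s' => k - s'.imem 9) (fun s' h' => ?_) (fun s' h' h9 => ?_) ⟨e₀, ?_, ?_⟩).mono ?_ ?_)
  · have := (h.of_same h'.1).cell_k
    simp (disch := omega) [BExpr.eval, this]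
  · obtain ⟨e, h1, h2⟩ := h'
    have e1 := e.trans (SameSearch.update s' (a := 16 + s'.imem 9) (by omega) 0)
    refine Runs.seq (Runs.setI (i := 16 + s'.imem 9) (v := 0) (by simp (disch := omega))
      (by omega) (by simp (disch := omega)) ?_)
    refine Runs.setI (i := 9) (v := s'.imem 9 + 1) (by simp (disch := omega))
      (by omega) (by simp (disch := omega) [Function.update_of_ne])
      ⟨⟨e1.trans (SameSearch.update _ (by omega) _), ?_, ?_⟩, ?_⟩
    · simpa using h9
    · simp only [Function.update_self]
      intro c hc
      rcases Nat.lt_succ_iff_lt_or_eq.1 hc with hc | rfl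
      · have := h2 c hc
        simpa (disch := omega) [Function.update_of_ne]
      · simp (disch := omega) [Function.update_of_ne]
    · simp only [Function.update_self]
      omega
  · simp [hs₀]
  · simp [hs₀]
  · simp only [BExpr.cost, IExpr.cost]
    gcongr
    omega
  · rintro s' ⟨⟨e, h1, h2⟩, h3⟩
    exact (runs_clearPointers (h.of_same e) fun c hc => h2 c (by omega)).mono le_rfl
      fun s'' h'' => ⟨e.trans h''.1, h''.2⟩

end Reset

/-! ### Recording a better rectangle -/

section Improve

variable {n k W S : ℕ}

/-- Lower real cell `10` to the value of `e` if that is smaller. -/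
def lowerTo (e : RExpr) : Cmd := .ite (.rlt e (rvar 10)) (.setR (.const 10) e) .skip

def depthCmd : Cmd :=
  .seq (.setR (.const 10) (.sub (.x (ivar 9)) leftX))
    (.seq (lowerTo (.sub rightX (.x (ivar 9))))
      (.seq (lowerTo (.sub (.y (ivar 9)) bottomY)) (lowerTo (.sub (yPred 5) (.y (ivar 9))))))

/-- All `n` entries are scanned, without a test for membership: outside the rectangle the depth is
negative and cannot beat real cell `9`, which starts at zero. -/
def improveBody : Cmd :=
  .seq depthCmd
    (.seq (.ite (.and (.rlt (rvar 9) (rvar 10)) (.rlt (rvar 10) (rvar 8)))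
        (.setR (.const 9) (rvar 10)) .skip)
      (.setI (.const 9) (.add (ivar 9) (.const 1))))

def recordCmd : Cmd :=
  .seq (.setR (.const 0) leftX) (.seq (.setR (.const 1) rightX) (.seq (.setR (.const 2) bottomY)
    (.seq (.setR (.const 3) (yPred 5)) (.setR (.const 8) (rvar 9)))))

def improveCmd : Cmd :=
  .seq (.setR (.const 9) (.const 0)) (.seq (.setI (.const 9) (.const 0))
    (.seq (.while (.ilt (ivar 9) (ivar 0)) improveBody) recordCmd))

theorem runs_lowerTo {s : RamState n k} (hW : 32 ≤ W) (hS : 32 ≤ S) {e : RExpr} {v : ℝ}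
    (he : e.eval W S s = some v) {Q : RamState n k → Prop}
    (hQ : Q { s with rmem := Function.update s.rmem 10 (min (s.rmem 10) v) }) :
    Runs W S (lowerTo e) s (lowerTo e).bound Q := by
  refine Runs.ite (p := v < s.rmem 10) ?_ (fun hp => ?_) fun hp => ?_
  · simp (disch := omega) [BExpr.eval, he]
  · rw [min_eq_right hp.le] at hQ
    exact Runs.setR (i := 10) (by simp (disch := omega)) (by omega) he hQ
  · rw [min_eq_left (not_lt.1 hp), Function.update_eq_self] at hQ
    exact Runs.skip hQ

/-- The distance of a point of the current rectangle from its boundary. -/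
noncomputable def depth (s : RamState n k) (p : ℕ) : ℝ :=
  min (min (min (xs s.pts p - sideL s) (sideR s - xs s.pts p)) (ys s.pts p - sideB s))
    (ys s.pts (s.imem 5 - 1) - ys s.pts p)

theorem runs_depthCmd {s : RamState n k} (h : SearchOk W S s) (h5 : s.imem 5 ≤ n)
    (h9 : s.imem 9 < n) :
    Runs W S depthCmd s depthCmd.bound fun s' =>
      s' = { s with rmem := Function.update s.rmem 10 (depth s (s.imem 9)) } := by
  have hW := h.words
  have hS := h.cells
  have hk := h.colors_pos
  have hkn := h.colors_le
  have h2 := h.left_lt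
  have h3 := h.right_lt
  have h4 := h.bottom_lt
  have h5' : s.imem 5 - 1 < n := by omega
  refine Runs.seq (Runs.setR (i := 10) (v := xs s.pts (s.imem 9) - sideL s)
    (by simp (disch := omega)) (by omega) (by simp (disch := omega)) ?_)
  refine Runs.seq (runs_lowerTo (by omega) (by omega) (v := sideR s - xs s.pts (s.imem 9))
    (by simp (disch := omega)) ?_)
  refine Runs.seq (runs_lowerTo (by omega) (by omega) (v := ys s.pts (s.imem 9) - sideB s)
    (by simp (disch := omega)) ?_)
  refine runs_lowerTo (by omega) (by omega)
    (v := ys s.pts (s.imem 5 - 1) - ys s.pts (s.imem 9))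
    (by simp (disch := omega)) ?_
  simp [depth]

/-- The state during the search for the new width. -/
structure ImproveInv (s s' : RamState n k) : Prop where
  pts : s'.pts = s.pts
  imem : ∀ a < 9, s'.imem a = s.imem a
  width : s'.rmem 8 = s.rmem 8
  index_le : s'.imem 9 ≤ n
  attained : s'.rmem 9 = 0 ∨ ∃ p < n, s'.rmem 9 = depth s p
  nonneg : 0 ≤ s'.rmem 9
  lt : s'.rmem 9 < s.rmem 8
  le : ∀ p < s'.imem 9, depth s p < s.rmem 8 → depth s p ≤ s'.rmem 9

theorem SearchOk.of_eq {s s' : RamState n k} (h : SearchOk W S s) (hp : s'.pts = s.pts)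
    (hi : ∀ a < 5, s'.imem a = s.imem a) (hw : 0 < s'.rmem 8) : SearchOk W S s' := by
  obtain ⟨h1, h2, h3, h4, h5, h6, h7, h8, h9, h10, h11⟩ := h
  refine ⟨h1, h2, h3, h4, ?_, ?_, ?_, ?_, ?_, ?_, hw⟩ <;> simp [*]

theorem runs_improveBody {s s' : RamState n k} (h : SearchOk W S s) (h5 : s.imem 5 ≤ n)
    (I : ImproveInv s s') (h9 : s'.imem 9 < n) :
    Runs W S improveBody s' improveBody.bound fun s'' =>
      ImproveInv s s'' ∧ n - s''.imem 9 < n - s'.imem 9 := by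
  have h' := h.of_eq I.pts (fun a ha => I.imem a (by omega)) (I.width ▸ h.width_pos)
  have hW := h.words
  have hS := h.cells
  have hk := h.colors_pos
  have hkn := h.colors_le
  have hd : depth s' (s'.imem 9) = depth s (s'.imem 9) := by
    simp [depth, sideL, sideR, sideB, I.pts, I.imem]
  refine Runs.seq ((runs_depthCmd h' (by rw [I.imem 5 (by omega)]; exact h5) h9).mono le_rfl ?_)
  rintro _ rfl
  rw [hd]
  refine Runs.seq (Runs.mono (Q := fun s'' => s''.imem = s'.imem ∧ s''.pts = s'.pts ∧
    s''.rmem 8 = s'.rmem 8 ∧ s''.rmem 9 = if s'.rmem 9 < depth s (s'.imem 9) ∧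
      depth s (s'.imem 9) < s'.rmem 8 then depth s (s'.imem 9) else s'.rmem 9) (Runs.ite
    (p := s'.rmem 9 < depth s (s'.imem 9) ∧ depth s (s'.imem 9) < s'.rmem 8) ?_
    (fun hp => ?_) fun hp => ?_) le_rfl ?_)
  · simp (disch := omega) [BExpr.eval]
  · refine Runs.setR (i := 9) (v := depth s (s'.imem 9)) (by simp (disch := omega)) (by omega)
      (by simp (disch := omega)) ⟨rfl, rfl, ?_, ?_⟩ <;> simp [hp]
  · refine Runs.skip ⟨rfl, rfl, ?_, ?_⟩ <;> simp [hp]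
  · rintro t ⟨e1, e2, e3, e4⟩
    rw [← e1] at h9
    refine Runs.setI (i := 9) (v := t.imem 9 + 1) (by simp (disch := omega)) (by omega)
      (by simp (disch := omega)) ⟨⟨?_, ?_, ?_, ?_, ?_, ?_, ?_, ?_⟩, ?_⟩
    · exact e2.trans I.pts
    · intro a ha
      have := I.imem a ha
      rw [← e1] at this
      simpa (disch := omega) [Function.update_of_ne]
    · exact e3.trans I.width
    · simpa using h9
    · simp only [e4]
      split_ifs
      · exact .inr ⟨s'.imem 9, by rwa [← e1], rfl⟩
      · exact I.attained
    · simp only [e4]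
      have := I.nonneg
      split_ifs with hc
      · exact this.trans hc.1.le
      · exact this
    · simp only [e4]
      split_ifs with hc
      · rw [← I.width]
        exact hc.2
      · exact I.lt
    · simp only [e4, Function.update_self]
      intro p hp hlt
      rw [e1] at hp
      rcases Nat.lt_succ_iff_lt_or_eq.1 hp with hp | rfl
      · have := I.le p hp hlt
        split_ifs with hc
        · exact this.trans hc.1.le
        · exact this
      · split_ifs with hc
        · exact le_rfl
        · rw [I.width, and_comm, not_and] at hc
          exact not_lt.1 (hc hlt)
    · simp only [Function.update_self, ← e1]
      omega

theorem isDiff_depth {s : RamState n k} (h : SearchOk W S s) (h5 : s.imem 5 ≤ n) {p : ℕ}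
    (hp : p < n) : IsDiff s.pts (depth s p) := by
  have hq : s.imem 5 - 1 < n := by omega
  unfold depth
  rcases min_choice (min (min (xs s.pts p - sideL s) (sideR s - xs s.pts p))
    (ys s.pts p - sideB s)) (ys s.pts (s.imem 5 - 1) - ys s.pts p) with e | e <;> rw [e]
  · rcases min_choice (min (xs s.pts p - sideL s) (sideR s - xs s.pts p))
      (ys s.pts p - sideB s) with e | e <;> rw [e]
    · rcases min_choice (xs s.pts p - sideL s) (sideR s - xs s.pts p) with e | e <;> rw [e]
      · exact ⟨p, hp, _, h.left_lt, .inl rfl⟩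
      · exact ⟨_, h.right_lt, p, hp, .inl rfl⟩
    · exact ⟨p, hp, _, h.bottom_lt, .inr rfl⟩
  · exact ⟨_, hq, p, hp, .inr rfl⟩

/-- The annulus fits because a positive new width is the depth of a point: adding its distances from
two opposite sides gives twice the width at most the side length. It spans because the new width is
maximal among the depths below the old one. -/
theorem ImproveInv.spans {s s' : RamState n k} (h : SearchOk W S s) (h5 : s.imem 5 ≤ n)
    (hs : Improves s) (I : ImproveInv s s') (h9 : s'.imem 9 = n) :
    Spans s.pts (sideL s) (sideR s) (sideB s) (ys s.pts (s.imem 5 - 1)) (s'.rmem 9) := by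
  obtain ⟨hq, hall⟩ := hs
  have hle : ∀ p < s.imem 5, ys s.pts p ≤ ys s.pts (s.imem 5 - 1) := fun p hp =>
    h.sorted p _ (by omega) (by omega)
  have h0 : 2 * s'.rmem 9 ≤ sideR s - sideL s ∧
      2 * s'.rmem 9 ≤ ys s.pts (s.imem 5 - 1) - sideB s := by
    rcases I.attained with he | ⟨p, hp, he⟩
    · obtain ⟨p, hp, -, ⟨s1, s2, s3⟩, -⟩ := hall 0 h.colors_pos
      have := hle p hp
      constructor <;> linarith
    · have hm := he.le
      simp only [depth, le_min_iff] at hm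
      obtain ⟨⟨⟨m1, m2⟩, m3⟩, m4⟩ := hm
      constructor <;> linarith
  refine ⟨I.nonneg, h0.1, h0.2, fun c hc => ?_⟩
  obtain ⟨p, hp, hpc, hs, hn⟩ := hall c hc
  refine ⟨p, by omega, hpc, hs, hle p hp, ?_⟩
  have hd : depth s p < s.rmem 8 := by
    simp only [depth, min_lt_iff]
    rcases hn with (h | h | h) | h <;> tauto
  have hd' := I.le p (by omega) hd
  simp only [depth, min_le_iff] at hd'
  tauto

theorem runs_improveCmd {s : RamState n k} (h : SearchOk W S s) (h5 : s.imem 5 ≤ n)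
    (hs : Improves s) :
    Runs W S improveCmd s (3 + (3 + ((6 + improveBody.bound) * n + 6 + recordCmd.bound)))
      fun s' => s'.pts = s.pts ∧ (∀ a < 5, s'.imem a = s.imem a) ∧
        Spans s.pts (s'.rmem 0) (s'.rmem 1) (s'.rmem 2) (s'.rmem 3) (s'.rmem 8) ∧
        s'.rmem 8 < s.rmem 8 ∧ IsDiff s.pts (s'.rmem 8) := by
  have hW := h.words
  have hS := h.cells
  have hk := h.colors_pos
  have hkn := h.colors_le
  refine Runs.seq' (T := 3) (Runs.setR (i := 9) (v := 0) (by simp (disch := omega)) (by omega)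
    (by simp) ?_)
  refine Runs.seq' (T := 3) (Runs.setI (i := 9) (v := 0) (by simp (disch := omega)) (by omega)
    (by simp (disch := omega)) ?_)
  set s₀ : RamState n k := { s with
    imem := Function.update s.imem 9 0, rmem := Function.update s.rmem 9 0 } with hs₀
  have I₀ : ImproveInv s s₀ := by
    refine ⟨rfl, fun a ha => ?_, ?_, ?_, ?_, ?_, ?_, ?_⟩
    · simp (disch := omega) [hs₀, Function.update_of_ne]
    · simp [hs₀]
    · simp [hs₀]
    · simp [hs₀]
    · simp [hs₀]
    · simpa [hs₀] using h.width_pos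
    · simp [hs₀]
  refine Runs.seq' ((Runs.while' (T := improveBody.bound) (fun s => s.imem 9 < n) (ImproveInv s)
    (fun s' => n - s'.imem 9) (fun s' h' => ?_) (fun s' h' h9 => runs_improveBody h h5 h' h9)
    I₀).mono ?_ ?_)
  · have := (h'.imem 0 (by omega)).trans h.cell_n
    simp (disch := omega) [BExpr.eval, this]
  · simp only [BExpr.cost, IExpr.cost]
    gcongr
    omega
  rintro s' ⟨I, h9⟩
  have h9' : s'.imem 9 = n := by
    have := I.index_le
    omega
  have hsp := I.spans h h5 hs h9'
  have h' := h.of_eq I.pts (fun a ha => I.imem a (by omega)) (I.width ▸ h.width_pos)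
  have l2 := h'.left_lt
  have l3 := h'.right_lt
  have l4 := h'.bottom_lt
  have l5 : s'.imem 5 - 1 < n := by
    rw [I.imem 5 (by omega)]
    omega
  refine Runs.seq (Runs.setR (i := 0) (v := xs s'.pts (s'.imem 2)) (by simp (disch := omega))
    (by omega) (by simp (disch := omega)) ?_)
  refine Runs.seq (Runs.setR (i := 1) (v := xs s'.pts (s'.imem 3)) (by simp (disch := omega))
    (by omega) (by simp (disch := omega)) ?_)
  refine Runs.seq (Runs.setR (i := 2) (v := ys s'.pts (s'.imem 4)) (by simp (disch := omega))
    (by omega) (by simp (disch := omega)) ?_)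
  refine Runs.seq (Runs.setR (i := 3) (v := ys s'.pts (s'.imem 5 - 1)) (by simp (disch := omega))
    (by omega) (by simp (disch := omega)) ?_)
  refine Runs.setR (i := 8) (v := s'.rmem 9) (by simp (disch := omega))
    (by omega) (by simp (disch := omega)) ⟨I.pts, fun a ha => I.imem a (by omega), ?_, ?_, ?_⟩
  · simpa [I.pts, I.imem] using hsp
  · simpa using I.lt
  · simp only [Function.update_self]
    rcases I.attained with e | ⟨p, hp, e⟩
    · rw [e]
      -- Width zero also counts as a coordinate difference, of a point with itself.
      exact ⟨0, by omega, 0, by omega, .inl (sub_self _).symm⟩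
    · rw [e]
      exact isDiff_depth h h5 hp

end Improve

/-! ### The search over all triples of sides -/

section Search

variable {n k W S : ℕ}

def advanceCmd : Cmd :=
  .seq (.setI (.const 4) (.add (ivar 4) (.const 1)))
    (.ite (.ilt (ivar 4) (ivar 0)) .skip
      (.seq (.setI (.const 4) (.const 0)) (.seq (.setI (.const 3) (.add (ivar 3) (.const 1)))
        (.ite (.ilt (ivar 3) (ivar 0)) .skip
          (.seq (.setI (.const 3) (.const 0)) (.setI (.const 2) (.add (ivar 2) (.const 1))))))))

/-- After an improvement the same triple is swept again with the smaller width; only an exhausted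
sweep advances the triple. -/
def searchBody : Cmd :=
  .seq resetCmd (.seq sweepLoop (.ite (.ilt (ivar 8) (.const 2)) improveCmd advanceCmd))

def searchLoop : Cmd := .while (.and (.ilt (ivar 2) (ivar 0)) (.rlt (.const 0) (rvar 8))) searchBody

/-- The position of a triple of indices in lexicographic order. -/
def tripleCode (n i j m : ℕ) : ℕ := (i * n + j) * n + m

theorem tripleCode_lt {i j m : ℕ} (hi : i < n) (hj : j < n) (hm : m < n) :
    tripleCode n i j m < n ^ 3 := by
  unfold tripleCode
  have h1 : i * n + j + 1 ≤ n * n := by nlinarith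
  have h2 : (i * n + j + 1) * n ≤ n * n * n := Nat.mul_le_mul_right _ h1
  have h3 : (i * n + j + 1) * n = (i * n + j) * n + n := by ring
  have h4 : n ^ 3 = n * n * n := by ring
  omega

theorem tripleCode_inj {i j m i' j' m' : ℕ} (hj : j < n) (hm : m < n) (hj' : j' < n)
    (hm' : m' < n) (h : tripleCode n i j m = tripleCode n i' j' m') : i = i' ∧ j = j' ∧ m = m' := by
  have key : ∀ {a b c d : ℕ}, b < n → d < n → a * n + b = c * n + d → a = c ∧ b = d := by
    intro a b c d hb hd h
    have h1 : a = c := by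
      have := congrArg (· / n) h
      simpa [Nat.add_div_of_dvd_right, Nat.div_eq_of_lt, hb, hd, show 0 < n by omega] using this
    subst h1
    exact ⟨rfl, by omega⟩
  obtain ⟨h1, h2⟩ := key hm hm' h
  obtain ⟨h3, h4⟩ := key hj hj' h1
  exact ⟨h3, h4, h2⟩

theorem runs_advanceCmd {s : RamState n k} (h : SearchOk W S s) :
    Runs W S advanceCmd s advanceCmd.bound fun s' => s'.pts = s.pts ∧ s'.rmem = s.rmem ∧
      s'.imem 0 = n ∧ s'.imem 1 = k ∧ s'.imem 2 ≤ n ∧ s'.imem 3 < n ∧ s'.imem 4 < n ∧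
      tripleCode n (s'.imem 2) (s'.imem 3) (s'.imem 4) =
        tripleCode n (s.imem 2) (s.imem 3) (s.imem 4) + 1 := by
  have hW := h.words
  have hS := h.cells
  have hk := h.colors_pos
  have hkn := h.colors_le
  have h0 := h.cell_n
  have h1 := h.cell_k
  have h2 := h.left_lt
  have h3 := h.right_lt
  have h4 := h.bottom_lt
  refine Runs.seq (Runs.setI (i := 4) (v := s.imem 4 + 1) (by simp (disch := omega)) (by omega)
    (by simp (disch := omega)) ?_)
  refine Runs.ite (p := s.imem 4 + 1 < n) (by simp (disch := omega) [BExpr.eval, h0])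
    (fun hp => ?_) fun hp => ?_
  · refine Runs.skip ⟨rfl, rfl, ?_⟩
    simp [h0, h1, h2.le, h3, hp, tripleCode]
    ring
  have e4 : s.imem 4 + 1 = n := by omega
  refine Runs.seq (Runs.setI (i := 4) (v := 0) (by simp (disch := omega)) (by omega)
    (by simp (disch := omega)) ?_)
  refine Runs.seq (Runs.setI (i := 3) (v := s.imem 3 + 1) (by simp (disch := omega)) (by omega)
    (by simp (disch := omega)) ?_)
  refine Runs.ite (p := s.imem 3 + 1 < n) (by simp (disch := omega) [BExpr.eval, h0])
    (fun hp' => ?_) fun hp' => ?_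
  · refine Runs.skip ⟨rfl, rfl, ?_⟩
    simp [h0, h1, h2.le, hp', tripleCode]
    refine ⟨by omega, ?_⟩
    rw [add_assoc _ (s.imem 4), e4]
    ring
  have e3 : s.imem 3 + 1 = n := by omega
  refine Runs.seq (Runs.setI (i := 3) (v := 0) (by simp (disch := omega)) (by omega)
    (by simp (disch := omega)) ?_)
  refine Runs.setI (i := 2) (v := s.imem 2 + 1) (by simp (disch := omega)) (by omega)
    (by simp (disch := omega)) ⟨rfl, rfl, ?_⟩
  simp [h0, h1, tripleCode]
  refine ⟨by omega, by omega, ?_⟩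
  rw [add_assoc _ (s.imem 4), e4, show s.imem 3 = n - 1 by omega]
  obtain ⟨d, rfl⟩ : ∃ d, n = d + 1 := ⟨n - 1, by omega⟩
  simp only [Nat.add_sub_cancel]
  ring

/-- The state during the search. -/
structure SearchInv (P : Fin n → ColoredPoint k) (s : RamState n k) : Prop where
  pts : s.pts = P
  cell_n : s.imem 0 = n
  cell_k : s.imem 1 = k
  left_le : s.imem 2 ≤ n
  right_lt : s.imem 3 < n
  bottom_lt : s.imem 4 < n
  width_nonneg : 0 ≤ s.rmem 8
  best : s.rmem 8 = ys P (n - 1) - ys P 0 + 1 ∨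
    Spans P (s.rmem 0) (s.rmem 1) (s.rmem 2) (s.rmem 3) (s.rmem 8)
  past : ∀ i < n, ∀ j < n, ∀ m < n,
    tripleCode n i j m < tripleCode n (s.imem 2) (s.imem 3) (s.imem 4) →
      ∀ z < n, NoImprovement P (xs P i) (xs P j) (ys P m) (s.rmem 8) z

/-- An exhausted triple lowers the first summand by one and keeps the width; an improvement keeps
the triple and lowers the second summand. -/
noncomputable def searchPotential (P : Fin n → ColoredPoint k) (s : RamState n k) : ℕ :=
  (n ^ 3 - tripleCode n (s.imem 2) (s.imem 3) (s.imem 4)) + diffCount P (s.rmem 8)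

/-- A bound for the time that one triple or one improvement takes, divided by `n`. -/
def searchFactor : ℕ :=
  3 + (6 + clearBody.bound + 6 + clearPointers.bound) + ((5 + sweepBody.bound) * 3 + 5) +
    (5 + (3 + (3 + (6 + improveBody.bound + 6 + recordCmd.bound)) + advanceCmd.bound))

theorem runs_searchBody {P : Fin n → ColoredPoint k} (hP : SortedByY P) (hW : 32 * n ≤ W)
    (hS : 32 * k ≤ S) (hk : 0 < k) (hkn : k ≤ n) {s : RamState n k} (I : SearchInv P s)
    (hs : s.imem 2 < n ∧ 0 < s.rmem 8) :
    Runs W S searchBody s (searchFactor * n) fun s' =>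
      SearchInv P s' ∧ searchPotential P s' < searchPotential P s := by
  obtain ⟨hi, hw⟩ := hs
  obtain rfl := I.pts
  have h : SearchOk W S s := ⟨hW, hS, hk, hkn, I.cell_n, I.cell_k, hi, I.right_lt, I.bottom_lt, hP, hw⟩
  refine Runs.mono (T := 3 + ((6 + clearBody.bound) * n + 6 + clearPointers.bound) +
    (((5 + sweepBody.bound) * (2 * n + 1) + 5) + (4 + 1 +
      max (3 + (3 + ((6 + improveBody.bound) * n + 6 + recordCmd.bound))) advanceCmd.bound)))
    (Runs.seq' ((runs_resetCmd h).mono le_rfl ?_)) ?_ (fun _ h => h)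
  · rintro s₁ ⟨e₁, I₁⟩
    have ok₁ := h.of_same e₁
    refine Runs.seq' ((runs_sweepLoop ok₁ I₁).mono le_rfl ?_)
    rintro s₂ ⟨e₂, hc⟩
    have e := e₁.trans e₂
    have ok₂ := h.of_same e
    refine Runs.ite' (v := decide (s₂.imem 8 < 2)) (by simp (disch := omega) [BExpr.eval])
      (fun h8 => ?_) fun h8 => ?_
    · obtain ⟨-, h5, himp⟩ := hc.resolve_right (fun hc => by simp [hc.1] at h8)
      refine (runs_improveCmd ok₂ h5 himp).mono le_rfl ?_
      rintro s₃ ⟨q1, q2, q3, q4, q5⟩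
      rw [e.pts] at q1 q3 q5
      have q2' : ∀ a < 5, s₃.imem a = s.imem a := fun a ha => (q2 a ha).trans (e.imem a ha)
      rw [e.rmem] at q4
      refine ⟨⟨q1, ?_, ?_, ?_, ?_, ?_, q3.width_nonneg, .inr q3, ?_⟩, ?_⟩
      · simpa [q2'] using I.cell_n
      · simpa [q2'] using I.cell_k
      · simpa [q2'] using I.left_le
      · simpa [q2'] using I.right_lt
      · simpa [q2'] using I.bottom_lt
      · intro i hi j hj m hm hlt z hz
        refine (I.past i hi j hj m hm ?_ z hz).anti q4.le
        simpa [q2'] using hlt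
      · have := diffCount_lt q4 q5
        simpa [searchPotential, q2'] using this
    · obtain ⟨-, hno⟩ := hc.resolve_left (fun hc => by simp [hc.1] at h8)
      refine (runs_advanceCmd ok₂).mono le_rfl ?_
      rintro s₃ ⟨q1, q2, q3, q4, q5, q6, q7, q8⟩
      rw [e.pts] at q1
      rw [e.rmem] at q2
      rw [e.imem 2 (by omega), e.imem 3 (by omega), e.imem 4 (by omega)] at q8
      refine ⟨⟨q1, q3, q4, q5, q6, q7, ?_, ?_, ?_⟩, ?_⟩
      · rw [q2]
        exact I.width_nonneg
      · rw [q2]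
        exact I.best
      · rw [q2, q8]
        intro i hi' j hj m hm hlt z hz
        rcases Nat.lt_succ_iff_lt_or_eq.1 hlt with hlt | heq
        · exact I.past i hi' j hj m hm hlt z hz
        -- The only new code is that of the triple just swept.
        · obtain ⟨rfl, rfl, rfl⟩ := tripleCode_inj hj hm I.right_lt I.bottom_lt heq
          exact e₁.noImprovementAt_iff.1 (hno z hz)
      · have := tripleCode_lt hi I.right_lt I.bottom_lt
        simp only [searchPotential, q2, q8]
        omega
  · have hn : 1 ≤ n := by omega
    -- Three inner loops are linear in `n`; the constant terms are absorbed using `1 ≤ n`.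
    have hmax : max (3 + (3 + ((6 + improveBody.bound) * n + 6 + recordCmd.bound)))
        advanceCmd.bound ≤ (3 + (3 + ((6 + improveBody.bound) * n + 6 + recordCmd.bound))) +
          advanceCmd.bound := by omega
    unfold searchFactor
    generalize clearBody.bound = a at *
    generalize clearPointers.bound = b at *
    generalize sweepBody.bound = c at *
    generalize improveBody.bound = d at *
    generalize recordCmd.bound = e at *
    generalize advanceCmd.bound = f at *
    nlinarith [Nat.mul_le_mul_left b hn, Nat.mul_le_mul_left c hn, Nat.mul_le_mul_left e hn,
      Nat.mul_le_mul_left f hn]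

theorem runs_searchLoop {P : Fin n → ColoredPoint k} (hP : SortedByY P) (hW : 32 * n ≤ W)
    (hS : 32 * k ≤ S) (hk : 0 < k) (hkn : k ≤ n) {s : RamState n k} (I : SearchInv P s) :
    Runs W S searchLoop s ((11 + searchFactor * n) * (n ^ 3 + 2 * n ^ 2) + 11) fun s' =>
      SearchInv P s' ∧ ¬ (s'.imem 2 < n ∧ 0 < s'.rmem 8) := by
  refine (Runs.while' (T := searchFactor * n) (fun s => s.imem 2 < n ∧ 0 < s.rmem 8) (SearchInv P)
    (searchPotential P) (fun s h => ?_) (fun s h hs => runs_searchBody hP hW hS hk hkn h hs)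
    I).mono ?_ (fun _ h => h)
  · have := h.cell_n
    simp (disch := omega) [BExpr.eval, this]
  · simp only [BExpr.cost, IExpr.cost, RExpr.cost]
    have h1 : searchPotential P s ≤ n ^ 3 + 2 * n ^ 2 :=
      add_le_add (Nat.sub_le _ _) (diffCount_le _ _)
    gcongr

/-- The initial width exceeds the height of the point set, so some triple must improve on it and the
uninitialized rectangle is never output. -/
def startCmd : Cmd :=
  .seq (.setR (.const 8) (.add (.sub (yPred 0) (.y (.const 0))) (.const 1)))
    (.seq (.setI (.const 2) (.const 0)) (.seq (.setI (.const 3) (.const 0))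
      (.setI (.const 4) (.const 0))))

theorem runs_startCmd {s : RamState n k} (hP : SortedByY s.pts) (hW : 32 * n ≤ W) (hS : 32 ≤ S)
    (hn : 0 < n) (h0 : s.imem 0 = n) (h1 : s.imem 1 = k) :
    Runs W S startCmd s startCmd.bound fun s' => SearchInv s.pts s' := by
  have h0' : s.imem 0 - 1 < n := by omega
  have hy : (RExpr.y (.const 0)).eval W S s = some (ys s.pts 0) :=
    RExpr.eval_y_of_lt (by simp) hn
  refine Runs.seq (Runs.setR (i := 8) (v := ys s.pts (n - 1) - ys s.pts 0 + 1)
    (by simp (disch := omega)) (by omega) (by simp (disch := omega) [hy, h0]) ?_)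
  refine Runs.seq (Runs.setI (i := 2) (v := 0) (by simp (disch := omega)) (by omega)
    (by simp (disch := omega)) ?_)
  refine Runs.seq (Runs.setI (i := 3) (v := 0) (by simp (disch := omega)) (by omega)
    (by simp (disch := omega)) ?_)
  refine Runs.setI (i := 4) (v := 0) (by simp (disch := omega)) (by omega)
    (by simp (disch := omega)) ⟨rfl, ?_, ?_, ?_, ?_, ?_, ?_, .inl ?_, ?_⟩
  · simpa using h0
  · simpa using h1
  · simp
  · simpa using hn
  · simpa using hn
  · have := hP 0 (n - 1) (Nat.zero_le _) (by omega)
    simp only [Function.update_self]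
    linarith
  · simp
  · simp [tripleCode]

end Search

/-! ### The output -/

section Output

variable {n k W S : ℕ}

/-- Make the upper end of the interval given by two adjacent real cells proper. -/
def properCmd (a b : ℕ) : Cmd :=
  .ite (.rlt (rvar a) (rvar b)) .skip (.setR (.const b) (.add (rvar a) (.const 1)))

def outputCmd : Cmd :=
  .seq (properCmd 0 1) (.seq (properCmd 2 3)
    (.seq (.setR (.const 4) (.add (rvar 0) (rvar 8))) (.seq (.setR (.const 5) (.sub (rvar 1) (rvar 8)))
      (.seq (.setR (.const 6) (.add (rvar 2) (rvar 8)))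
        (.setR (.const 7) (.sub (rvar 3) (rvar 8)))))))

theorem runs_properCmd {s : RamState n k} {a b : ℕ} (ha : a ≤ W) (hb : b ≤ W) (ha' : a < S)
    (hb' : b < S) :
    Runs W S (properCmd a b) s (properCmd a b).bound fun s' =>
      s' = { s with rmem := Function.update s.rmem b (properRight (s.rmem a) (s.rmem b)) } := by
  refine Runs.ite (p := s.rmem a < s.rmem b) ?_ (fun hp => ?_) fun hp => ?_
  · simp [BExpr.eval, ha, hb, ha', hb']
  · refine Runs.skip ?_
    rw [properRight, if_pos hp, Function.update_eq_self]
  · refine Runs.setR (i := b) (v := s.rmem a + 1) (by simp [hb]) hb' (by simp [ha, ha']) ?_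
    rw [properRight, if_neg hp]

theorem runs_outputCmd {s : RamState n k} (hW : 32 ≤ W) (hS : 32 ≤ S) :
    Runs W S outputCmd s outputCmd.bound fun s' =>
      outputOuter s' = outerRect (s.rmem 0) (s.rmem 1) (s.rmem 2) (s.rmem 3) ∧
      outputInner s' = innerRect (s.rmem 0) (s.rmem 1) (s.rmem 2) (s.rmem 3) (s.rmem 8) := by
  refine Runs.seq ((runs_properCmd (by omega) (by omega) (by omega) (by omega)).mono le_rfl ?_)
  rintro _ rfl
  refine Runs.seq ((runs_properCmd (by omega) (by omega) (by omega) (by omega)).mono le_rfl ?_)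
  rintro _ rfl
  refine Runs.seq (Runs.setR (i := 4) (v := s.rmem 0 + s.rmem 8) (by simp (disch := omega))
    (by omega) (by simp (disch := omega)) ?_)
  refine Runs.seq (Runs.setR (i := 5) (v := properRight (s.rmem 0) (s.rmem 1) - s.rmem 8)
    (by simp (disch := omega)) (by omega) (by simp (disch := omega)) ?_)
  refine Runs.seq (Runs.setR (i := 6) (v := s.rmem 2 + s.rmem 8) (by simp (disch := omega))
    (by omega) (by simp (disch := omega)) ?_)
  refine Runs.setR (i := 7) (v := properRight (s.rmem 2) (s.rmem 3) - s.rmem 8)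
    (by simp (disch := omega)) (by omega) (by simp (disch := omega)) ⟨?_, ?_⟩
  · simp [outputOuter, outerRect]
  · simp [outputInner, innerRect]

end Output

/-! ### Assembly of the program and the final bounds. -/

section Main

variable {n k W S : ℕ}

def annulusCmd : Cmd := .seq sortCmd (.seq startCmd (.seq searchLoop outputCmd))

/-- The running time of the whole program, divided by `n ^ 4`. -/
def annulusFactor : ℕ :=
  ((6 + sortBody.bound) * 3 + 6) + (startCmd.bound + (((11 + searchFactor) * 3 + 11) +
    outputCmd.bound))

theorem runs_annulusCmd (P : Fin n → ColoredPoint k) (hW : 32 * n ≤ W) (hS : 32 * k ≤ S)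
    (hk : 0 < k) (hsurj : ∀ c : Fin k, ∃ i : Fin n, (P i).color = c) :
    Runs W S annulusCmd (initState P) (annulusFactor * n ^ 4) fun s =>
      IsMinWidthCSRA P (outputOuter s) (outputInner s) := by
  have hkn : k ≤ n := by
    simpa using Fintype.card_le_of_surjective (fun i => (P i).color) hsurj
  have hn : 1 ≤ n := by omega
  refine Runs.mono (Runs.seq' ((runs_sortCmd P hW (by omega) (by omega)).mono le_rfl ?_))
    (T := ((6 + sortBody.bound) * (n * (n + 1) + n) + 6) + (startCmd.bound +
      (((11 + searchFactor * n) * (n ^ 3 + 2 * n ^ 2) + 11) + outputCmd.bound))) ?_ (fun _ h => h)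
  · rintro s ⟨h0, h1, ⟨σ, hσ⟩, hs⟩
    refine Runs.seq' ((runs_startCmd hs hW (by omega) hn h0 h1).mono le_rfl fun s₁ I₁ => ?_)
    refine Runs.seq' ((runs_searchLoop hs hW hS hk hkn I₁).mono le_rfl ?_)
    rintro s₂ ⟨I, hend⟩
    refine (runs_outputCmd (by omega) (by omega)).mono le_rfl ?_
    rintro s₃ ⟨e₁, e₂⟩
    rw [e₁, e₂]
    refine IsMinWidthCSRA.of_comp_perm (σ := σ) ?_
    rw [← hσ]
    refine isMinWidthCSRA_of_search hs hk (fun c hc => ?_) I.best ?_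
    · rw [← exists_index hc, hσ]
      obtain ⟨i, hi⟩ := hsurj ⟨c, hc⟩
      exact ⟨σ.symm i, by simpa using hi⟩
    -- The loop ends with all triples exhausted or with width zero, which no annulus can beat.
    · by_cases hw : 0 < s₂.rmem 8
      · refine .inr fun i hi j hj m hm z hz => I.past i hi j hj m hm ?_ z hz
        refine (tripleCode_lt hi hj hm).trans_le ?_
        have h2 : s₂.imem 2 = n := by
          have := I.left_le
          have : ¬ s₂.imem 2 < n := fun h => hend ⟨h, hw⟩
          omega
        rw [h2, tripleCode]
        calc n ^ 3 = n * n * n := by ring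
          _ ≤ (n * n + s₂.imem 3) * n + s₂.imem 4 := by nlinarith
      · exact .inl (not_lt.1 hw)
  · have h1 : 1 ≤ n ^ 4 := Nat.one_le_pow _ _ hn
    have h2 : n * (n + 1) + n ≤ 3 * n ^ 4 := by
      have : n ^ 2 ≤ n ^ 4 := Nat.pow_le_pow_right hn (by norm_num)
      nlinarith
    have h3 : (11 + searchFactor * n) * (n ^ 3 + 2 * n ^ 2) ≤ (11 + searchFactor) * 3 * n ^ 4 :=
      calc (11 + searchFactor * n) * (n ^ 3 + 2 * n ^ 2)
          ≤ ((11 + searchFactor) * n) * (3 * n ^ 3) := by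
            have : n ^ 2 ≤ n ^ 3 := Nat.pow_le_pow_right hn (by norm_num)
            refine Nat.mul_le_mul ?_ (by omega)
            nlinarith
        _ = (11 + searchFactor) * 3 * n ^ 4 := by ring
    have h4 := Nat.mul_le_mul_left (6 + sortBody.bound) h2
    have h5 := Nat.mul_le_mul_left startCmd.bound h1
    have h6 := Nat.mul_le_mul_left outputCmd.bound h1
    unfold annulusFactor
    nlinarith

end Main

theorem theorem2 :
    ∃ (prog : Cmd) (C : ℕ), ∀ (n k : ℕ) (P : Fin n → ColoredPoint k),
      0 < k → (∀ c : Fin k, ∃ i : Fin n, (P i).color = c) →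
        ∃ (t : ℕ) (s : RamState n k),
          Exec (C * n) (C * k) prog (initState P) t s ∧
          IsMinWidthCSRA P (outputOuter s) (outputInner s) ∧
          (2 ≤ n → (t : ℝ) ≤ C * (n : ℝ) ^ 4 * Real.log n) := by
  -- The `32` covers word size and memory, as `16 + k ≤ 32 * k` and `k ≤ n`; the factor `2` pays for
  -- `Real.log n ≥ 1 / 2`.
  refine ⟨annulusCmd, 32 + 2 * annulusFactor, fun n k P hk hsurj => ?_⟩
  obtain ⟨t, s, he, ht, hs⟩ := runs_annulusCmd P (W := (32 + 2 * annulusFactor) * n)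
    (S := (32 + 2 * annulusFactor) * k) (Nat.mul_le_mul_right _ (by omega))
    (Nat.mul_le_mul_right _ (by omega)) hk hsurj
  refine ⟨t, s, he, hs, fun hn => ?_⟩
  have hlog : (1 : ℝ) / 2 ≤ Real.log n := by
    have h1 : Real.log 2 ≤ Real.log n := Real.log_le_log (by norm_num) (by exact_mod_cast hn)
    have h2 := Real.log_two_gt_d9
    linarith
  have ht' : (t : ℝ) ≤ annulusFactor * (n : ℝ) ^ 4 := by exact_mod_cast ht
  calc (t : ℝ) ≤ annulusFactor * (n : ℝ) ^ 4 := ht'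
    _ ≤ (32 + 2 * annulusFactor) * (n : ℝ) ^ 4 * (1 / 2) := by
      have : (0 : ℝ) ≤ (n : ℝ) ^ 4 := by positivity
      linarith
    _ ≤ (32 + 2 * annulusFactor) * (n : ℝ) ^ 4 * Real.log n := by gcongr
    _ = _ := by push_cast; ring
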